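/- For $z\in\mathbb{C}$ and $b>0$ let $L_{z,b}$ be the operator in $L^2(\mathbb{R})$ formally given by \[ L_{z,b}\,y(x) = -y''(x) + \Bigl(\tfrac{x^2}{4}-\tfrac12\Bigr)y(x) + z\,\bigl[\delta(x-b)-\delta(x+b)\bigr]y(x), \] that is, the operator associated with the quadratic form \[ t_{z,b}(f,g) = \langle f',g'\rangle + \tfrac14\langle xf,xg\rangle - \tfrac12\langle f,g\rangle + z\bigl(f(b)\overline{g(b)} - f(-b)\overline{g(-b)}\bigr) \] with domain $\{f\in H^1(\mathbb{R}) : xf\in L^2(\mathbb{R})\}$, where $\langle u,v\rangle=\int_{\mathbb{R}}u\overline{v}\,dx$: $f$ belongs to the domain of $L_{z,b}$ and $L_{z,b}f=h\in L^2(\mathbb{R})$ if and only if $f$ belongs to the form domain and $t_{z,b}(f,g)=\langle h,g\rangle$ for every $g$ in the form domain. Let $D_\nu(x)$ denote the parabolic cylinder function, i.e. the solution of $-y''+(\tfrac{x^2}{4}-\tfrac12)y=\nu y$ with \[ D_\nu(0)=\frac{2^{\nu/2}\sqrt\pi}{\Gamma(\frac12-\frac\nu2)},\qquad D_\nu'(0)=-\frac{2^{(\nu+1)/2}\sqrt\pi}{\Gamma(-\frac\nu2)},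 \] where $1/\Gamma$ is the entire reciprocal Gamma function. Let $b>0$, let $\lambda>0$ be a real number that is not an integer and such that $D_\lambda(b)=0$, and let $\rho>0$. Then there is a constant $\delta=\delta(b,\lambda,\rho)>0$ such that for every real $r>1/\delta$ the operator $L_{ir,b}$ has two distinct non-real eigenvalues $\nu_1\neq\nu_2$ with $|\nu_1-\lambda|<\rho$ and $|\nu_2-\lambda|<\rho$. -/

import Mathlib

open MeasureTheory
open scoped ContDiff ComplexConjugate

namespace PointHarmonic

/-! ### Parabolic cylinder functions -/

/-- The even solution of the Weber equation `-y'' + (x²/4 - 1/2) y = ν y`,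
`e^{-x²/4} [1 + (-ν) x²/2! + (-ν)(-ν+2) x⁴/4! + ⋯]`, with `y(0) = 1`, `y'(0) = 0`. -/
noncomputable def yEven (ν x : ℂ) : ℂ :=
  Complex.exp (-x ^ 2 / 4) *
    ∑' k : ℕ, (∏ j ∈ Finset.range k, (-ν + 2 * (j : ℂ))) * x ^ (2 * k) /
      (Nat.factorial (2 * k) : ℂ)

/-- The odd solution of the Weber equation `-y'' + (x²/4 - 1/2) y = ν y`,
`e^{-x²/4} [x + (-ν+1) x³/3! + (-ν+1)(-ν+3) x⁵/5! + ⋯]`, with `y(0) = 0`, `y'(0) = 1`. -/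
noncomputable def yOdd (ν x : ℂ) : ℂ :=
  Complex.exp (-x ^ 2 / 4) *
    ∑' k : ℕ, (∏ j ∈ Finset.range k, (-ν + 1 + 2 * (j : ℂ))) * x ^ (2 * k + 1) /
      (Nat.factorial (2 * k + 1) : ℂ)

/-- The parabolic cylinder function `D_ν(x)`: the solution of the Weber equation with
`D_ν(0) = 2^{ν/2} √π / Γ(1/2 - ν/2)` and `D_ν'(0) = -2^{(ν+1)/2} √π / Γ(-ν/2)`.
Mathlib's `Complex.Gamma` is `0` at its poles, so that `(Complex.Gamma s)⁻¹` is the entire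
function `1/Γ` everywhere. -/
noncomputable def parabolicD (ν x : ℂ) : ℂ :=
  (2 : ℂ) ^ (ν / 2) * (Real.sqrt Real.pi : ℂ) * (Complex.Gamma (-ν / 2 + 1 / 2))⁻¹ * yEven ν x -
    (2 : ℂ) ^ ((ν + 1) / 2) * (Real.sqrt Real.pi : ℂ) * (Complex.Gamma (-ν / 2))⁻¹ * yOdd ν x

/-! ### The quadratic form -/

/-- `f'` is the weak (distributional) derivative of `f` on the real line. -/
def IsWeakDeriv (f f' : ℝ → ℂ) : Prop :=
  ∀ φ : ℝ → ℂ, ContDiff ℝ ∞ φ → HasCompactSupport φ →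
    ∫ x, f x * deriv φ x = -∫ x, f' x * φ x

/-- The pairing `⟨u, v⟩ = ∫ u v̄` of `L²(ℝ)`, linear in the first argument. -/
noncomputable def l2Pairing (u v : ℝ → ℂ) : ℂ := ∫ x, u x * conj (v x)

/-- The form domain `{f ∈ H¹(ℝ) : x f(x) ∈ L²(ℝ)}`. An element of `H¹(ℝ)` is given by its
continuous representative together with (a representative of) its weak derivative, which is
determined almost everywhere by the function. -/
structure FormDomain where
  /-- the continuous representative -/
  toFun : ℝ → ℂ
  /-- the weak derivative -/
  wderiv : ℝ → ℂ
  continuous_toFun : Continuous toFun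
  memLp_toFun : MemLp toFun 2 volume
  memLp_wderiv : MemLp wderiv 2 volume
  isWeakDeriv : IsWeakDeriv toFun wderiv
  memLp_mul : MemLp (fun x : ℝ => (x : ℂ) * toFun x) 2 volume

/-- The quadratic form of `-d²/dx² + (x²/4 - 1/2) + z (δ(x - b) - δ(x + b))`:
`⟨f', g'⟩ + ¼ ⟨x f, x g⟩ - ½ ⟨f, g⟩ + z (f(b) g(b)‾ - f(-b) g(-b)‾)`. -/
noncomputable def pcForm (z : ℂ) (b : ℝ) (f g : FormDomain) : ℂ :=
  l2Pairing f.wderiv g.wderiv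
    + 1 / 4 * l2Pairing (fun x : ℝ => (x : ℂ) * f.toFun x) (fun x : ℝ => (x : ℂ) * g.toFun x)
    - 1 / 2 * l2Pairing f.toFun g.toFun
    + z * (f.toFun b * conj (g.toFun b) - f.toFun (-b) * conj (g.toFun (-b)))

/-! ### Auxiliary facts: linearity in the first argument, and density of the form domain -/

theorem integrable_mul_conj {u v : ℝ → ℂ} (hu : MemLp u 2 volume) (hv : MemLp v 2 volume) :
    Integrable (fun x => u x * conj (v x)) :=
  hu.integrable_mul hv.star

theorem l2Pairing_add {u u' v : ℝ → ℂ} (hu : MemLp u 2 volume) (hu' : MemLp u' 2 volume)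
    (hv : MemLp v 2 volume) :
    l2Pairing (fun x => u x + u' x) v = l2Pairing u v + l2Pairing u' v := by
  unfold l2Pairing
  rw [← integral_add (integrable_mul_conj hu hv) (integrable_mul_conj hu' hv)]
  simp only [add_mul]

theorem l2Pairing_smul (c : ℂ) (u v : ℝ → ℂ) :
    l2Pairing (fun x => c * u x) v = c * l2Pairing u v := by
  unfold l2Pairing
  rw [← integral_const_mul]
  simp only [mul_assoc]

theorem l2Pairing_congr {u u' : ℝ → ℂ} (h : u =ᵐ[volume] u') (v : ℝ → ℂ) :
    l2Pairing u v = l2Pairing u' v := by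
  unfold l2Pairing
  apply integral_congr_ae
  filter_upwards [h] with x hx
  rw [hx]

theorem memLp_test {φ : ℝ → ℂ} (hφ : Continuous φ) (hc : HasCompactSupport φ) :
    MemLp φ 2 volume :=
  hφ.memLp_of_hasCompactSupport hc

namespace FormDomain

/-- The sum of two elements of the form domain. -/
def add (f g : FormDomain) : FormDomain where
  toFun x := f.toFun x + g.toFun x
  wderiv x := f.wderiv x + g.wderiv x
  continuous_toFun := f.continuous_toFun.add g.continuous_toFun
  memLp_toFun := f.memLp_toFun.add g.memLp_toFun
  memLp_wderiv := f.memLp_wderiv.add g.memLp_wderiv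
  isWeakDeriv := by
    intro φ hφ hc
    have hd : MemLp (deriv φ) 2 volume :=
      memLp_test (hφ.continuous_deriv (by simp)) hc.deriv
    have h0 : MemLp φ 2 volume := memLp_test hφ.continuous hc
    have i1 : Integrable (fun x => f.toFun x * deriv φ x) := f.memLp_toFun.integrable_mul hd
    have i2 : Integrable (fun x => g.toFun x * deriv φ x) := g.memLp_toFun.integrable_mul hd
    have i3 : Integrable (fun x => f.wderiv x * φ x) := f.memLp_wderiv.integrable_mul h0
    have i4 : Integrable (fun x => g.wderiv x * φ x) := g.memLp_wderiv.integrable_mul h0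
    simp only [add_mul]
    rw [integral_add i1 i2, integral_add i3 i4, f.isWeakDeriv φ hφ hc, g.isWeakDeriv φ hφ hc]
    ring
  memLp_mul := by
    simp only [mul_add]
    exact f.memLp_mul.add g.memLp_mul

/-- A scalar multiple of an element of the form domain. -/
def smul (c : ℂ) (f : FormDomain) : FormDomain where
  toFun x := c * f.toFun x
  wderiv x := c * f.wderiv x
  continuous_toFun := continuous_const.mul f.continuous_toFun
  memLp_toFun := f.memLp_toFun.const_mul c
  memLp_wderiv := f.memLp_wderiv.const_mul c
  isWeakDeriv := by
    intro φ hφ hc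
    simp only [mul_assoc]
    rw [integral_const_mul, integral_const_mul, f.isWeakDeriv φ hφ hc]
    ring
  memLp_mul := by
    simp only [mul_left_comm _ c]
    exact f.memLp_mul.const_mul c

/-- A test function as an element of the form domain. -/
noncomputable def ofTest (φ : ℝ → ℂ) (hφ : ContDiff ℝ ∞ φ) (hc : HasCompactSupport φ) :
    FormDomain where
  toFun := φ
  wderiv := deriv φ
  continuous_toFun := hφ.continuous
  memLp_toFun := memLp_test hφ.continuous hc
  memLp_wderiv := memLp_test (hφ.continuous_deriv (by simp)) hc.deriv
  isWeakDeriv := by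
    intro ψ hψ hcψ
    have c1 := hφ.continuous_deriv (by simp)
    have c2 := hψ.continuous_deriv (by simp)
    refine integral_mul_deriv_eq_deriv_mul_of_integrable
      (fun x _ => (hφ.differentiable (by simp) x).hasDerivAt)
      (fun x _ => (hψ.differentiable (by simp) x).hasDerivAt) ?_ ?_ ?_
    · exact (hφ.continuous.mul c2).integrable_of_hasCompactSupport (hc.mul_right)
    · exact (c1.mul hψ.continuous).integrable_of_hasCompactSupport (hcψ.mul_left)
    · exact (hφ.continuous.mul hψ.continuous).integrable_of_hasCompactSupport (hc.mul_right)
  memLp_mul := memLp_test (Complex.continuous_ofReal.mul hφ.continuous) hc.mul_left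

end FormDomain

theorem pcForm_add (z : ℂ) (b : ℝ) (f f' g : FormDomain) :
    pcForm z b (f.add f') g = pcForm z b f g + pcForm z b f' g := by
  simp only [pcForm, FormDomain.add, mul_add]
  rw [l2Pairing_add f.memLp_wderiv f'.memLp_wderiv g.memLp_wderiv,
    l2Pairing_add f.memLp_mul f'.memLp_mul g.memLp_mul,
    l2Pairing_add f.memLp_toFun f'.memLp_toFun g.memLp_toFun]
  ring

theorem pcForm_smul (z : ℂ) (b : ℝ) (c : ℂ) (f g : FormDomain) :
    pcForm z b (f.smul c) g = c * pcForm z b f g := by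
  simp only [pcForm, FormDomain.smul, mul_left_comm _ c, l2Pairing_smul]
  ring

/-- The derivative component of an element of the form domain that vanishes is negligible. -/
theorem wderiv_ae_zero (f : FormDomain) (h : f.toFun =ᵐ[volume] 0) :
    f.wderiv =ᵐ[volume] 0 := by
  refine ae_eq_zero_of_integral_contDiff_smul_eq_zero
    (f.memLp_wderiv.locallyIntegrable (by norm_num)) ?_
  intro φ hφ hc
  have hψ : ContDiff ℝ ∞ (fun x => (φ x : ℂ)) := Complex.ofRealCLM.contDiff.comp hφ
  have hcψ : HasCompactSupport (fun x => (φ x : ℂ)) := hc.comp_left Complex.ofReal_zero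
  have key := f.isWeakDeriv _ hψ hcψ
  have h0 : ∫ x, f.toFun x * deriv (fun x => (φ x : ℂ)) x = 0 := by
    rw [← integral_zero ℝ ℂ]
    apply integral_congr_ae
    filter_upwards [h] with x hx
    simp [hx]
  rw [h0] at key
  have : ∫ x, φ x • f.wderiv x = ∫ x, f.wderiv x * (φ x : ℂ) := by
    congr 1; ext x; rw [Complex.real_smul, mul_comm]
  rw [this]
  exact neg_eq_zero.mp key.symm

/-! ### The operator -/

/-- The graph in `L²(ℝ) × L²(ℝ)` of the operator associated with the quadratic form: the pairs
`(u, v)` such that `u` lies in the form domain and the form at `(u, g)` is `⟨v, g⟩` for all `g`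
in the form domain. -/
noncomputable def pcGraph (z : ℂ) (b : ℝ) :
    Submodule ℂ (Lp ℂ 2 (volume : Measure ℝ) × Lp ℂ 2 (volume : Measure ℝ)) where
  carrier := {p | ∃ f : FormDomain, f.toFun =ᵐ[volume] p.1 ∧
    ∀ g : FormDomain, pcForm z b f g = l2Pairing p.2 g.toFun}
  add_mem' := by
    rintro p q ⟨f, hf, hfg⟩ ⟨f', hf', hfg'⟩
    refine ⟨f.add f', ?_, fun g => ?_⟩
    · filter_upwards [hf, hf', Lp.coeFn_add p.1 q.1] with x h1 h2 h3
      change f.toFun x + f'.toFun x = (p.1 + q.1 : Lp ℂ 2 (volume : Measure ℝ)) x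
      rw [h1, h2, h3, Pi.add_apply]
    · rw [pcForm_add, hfg, hfg', ← l2Pairing_add (Lp.memLp p.2) (Lp.memLp q.2) g.memLp_toFun]
      exact (l2Pairing_congr (Lp.coeFn_add p.2 q.2) _).symm
  zero_mem' := by
    let f : FormDomain := FormDomain.ofTest 0 contDiff_const HasCompactSupport.zero
    refine ⟨f.smul 0, ?_, fun g => ?_⟩
    · filter_upwards [Lp.coeFn_zero ℂ 2 (volume : Measure ℝ)] with x h
      change (0 : ℂ) * f.toFun x = (0 : Lp ℂ 2 (volume : Measure ℝ)) x
      rw [h, zero_mul, Pi.zero_apply]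
    · rw [pcForm_smul]
      have : l2Pairing ((0 : Lp ℂ 2 (volume : Measure ℝ)) : ℝ → ℂ) g.toFun = 0 := by
        rw [l2Pairing_congr (Lp.coeFn_zero ℂ 2 (volume : Measure ℝ))]
        simp [l2Pairing]
      simpa using this.symm
  smul_mem' := by
    rintro c p ⟨f, hf, hfg⟩
    refine ⟨f.smul c, ?_, fun g => ?_⟩
    · filter_upwards [hf, Lp.coeFn_smul c p.1] with x h1 h2
      change c * f.toFun x = (c • p.1 : Lp ℂ 2 (volume : Measure ℝ)) x
      rw [h1, h2, Pi.smul_apply, smul_eq_mul]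
    · rw [pcForm_smul, hfg, ← l2Pairing_smul]
      exact (l2Pairing_congr (Lp.coeFn_smul c p.2) _).symm

/-- The graph is single-valued. -/
theorem pcGraph_single (z : ℂ) (b : ℝ)
    (p : Lp ℂ 2 (volume : Measure ℝ) × Lp ℂ 2 (volume : Measure ℝ))
    (hp : p ∈ pcGraph z b) (h0 : p.1 = 0) : p.2 = 0 := by
  obtain ⟨f, hf, hfg⟩ := hp
  have hf0 : f.toFun =ᵐ[volume] 0 := by
    rw [h0] at hf
    exact hf.trans (Lp.coeFn_zero ℂ 2 (volume : Measure ℝ))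
  have hfun : f.toFun = 0 :=
    (f.continuous_toFun.ae_eq_iff_eq volume continuous_zero).mp hf0
  have hz : ∀ g : FormDomain, pcForm z b f g = 0 := by
    intro g
    simp only [pcForm, l2Pairing_congr (wderiv_ae_zero f hf0), hfun]
    simp [l2Pairing]
  have hae : ∀ᵐ x, (p.2 : ℝ → ℂ) x = 0 := by
    refine ae_eq_zero_of_integral_contDiff_smul_eq_zero
      ((Lp.memLp p.2).locallyIntegrable (by norm_num)) ?_
    intro φ hφ hc
    have hψ : ContDiff ℝ ∞ (fun x => (φ x : ℂ)) := Complex.ofRealCLM.contDiff.comp hφ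
    have hcψ : HasCompactSupport (fun x => (φ x : ℂ)) := hc.comp_left Complex.ofReal_zero
    have key := hfg (FormDomain.ofTest _ hψ hcψ)
    rw [hz] at key
    rw [key]
    simp only [l2Pairing, FormDomain.ofTest]
    congr 1; ext x; rw [Complex.real_smul, mul_comm, Complex.conj_ofReal]
  exact (Lp.eq_zero_iff_ae_eq_zero).mpr hae

/-- The operator `L_{z,b} = -d²/dx² + (x²/4 - 1/2) + z (δ(x - b) - δ(x + b))`, as the unbounded
operator on `L²(ℝ)` associated with its quadratic form. -/
noncomputable def pcOperator (z : ℂ) (b : ℝ) :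
    Lp ℂ 2 (volume : Measure ℝ) →ₗ.[ℂ] Lp ℂ 2 (volume : Measure ℝ) :=
  (pcGraph z b).toLinearPMap

theorem pcOperator_graph (z : ℂ) (b : ℝ) : (pcOperator z b).graph = pcGraph z b :=
  Submodule.toLinearPMap_graph_eq _ fun p hp h0 => pcGraph_single z b p hp h0

/-- `ν` is an eigenvalue of the unbounded operator `T`. -/
def IsEigenvalue {E : Type*} [AddCommGroup E] [Module ℂ E] (T : E →ₗ.[ℂ] E) (ν : ℂ) : Prop :=
  ∃ y : T.domain, (y : E) ≠ 0 ∧ T y = ν • (y : E)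

end PointHarmonic

/-!
For `ν ∉ ℕ` the parabolic cylinder functions `D_ν(x)` and `D_ν(-x)` decay at `+∞` and `-∞`
respectively, and their Wronskian `W(ν)` does not vanish. Away from `±b` an eigenfunction of
`L_{z,b}` solves the Weber equation, so it is a combination `p G_b + q G_{-b}` of the Green
functions `G_s(x) = D_ν(max(x, s)) D_ν(-min(x, s))`. The jump conditions at `±b` are a homogeneous
`2 × 2` linear system for `(p, q)`, whose determinant vanishes exactly when `z² χ(ν) = 1`, where
`χ(ν) = D_ν(b)² (D_ν(-b)² - D_ν(b)²) / W(ν)²`.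

The function `χ` is analytic near `λ`, not constant, and vanishes at `λ`, so by the open mapping
theorem it takes the value `-1/r²` at a point `ν` near `λ` as soon as `r` is large. It is
nonnegative at the real points near `λ`, where `D_ν(b)` is close to `0` and `D_ν(-b)` is not, so
`ν` is not real; and `χ` commutes with complex conjugation, so the conjugate of `ν` is a second
eigenvalue.

The decay of `D_ν` at `+∞` comes from the integral representation
`Γ(-ν) D_ν(x) = e^{-x²/4} ∫₀^∞ t^{-ν-1} e^{-t²/2 - x t} dt` for `re ν < 0`, and from the recurrence
`D_{ν+1} = x D_ν - ν D_{ν-1}` for the other `ν`.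
-/

namespace PointHarmonic

open Filter Set Topology

/-! ### Weber series -/

/-- The `k`-th term of the Weber series `weberSeries a c x`. -/
noncomputable def weberTerm (a : ℕ) (c x : ℂ) (k : ℕ) : ℂ :=
  (∏ j ∈ Finset.range k, (c + 2 * (j : ℂ))) * x ^ (2 * k + a) / ((2 * k + a).factorial : ℂ)

/-- The Weber series `x^a/a! + c x^(a+2)/(a+2)! + c(c+2) x^(a+4)/(a+4)! + ⋯`. Up to the factor
`e^{-x²/4}` it is the even Weber solution for `a = 0`, `c = -ν`, and the odd one for `a = 1`,
`c = -ν + 1`; leaving `a` and `c` free makes the family closed under differentiation. -/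
noncomputable def weberSeries (a : ℕ) (c x : ℂ) : ℂ := ∑' k, weberTerm a c x k

theorem mul_prod_add_two (c : ℂ) (k : ℕ) :
    c * ∏ j ∈ Finset.range k, (c + 2 + 2 * (j : ℂ)) =
      ∏ j ∈ Finset.range (k + 1), (c + 2 * (j : ℂ)) := by
  rw [Finset.prod_range_succ', mul_comm]
  congr 1
  · exact Finset.prod_congr rfl fun j _ => by push_cast; ring
  · simp

theorem norm_prod_add_two_mul_le {c : ℂ} {R : ℝ} (hR : 1 ≤ R) (hc : ‖c‖ ≤ R) (k : ℕ) :
    ‖∏ j ∈ Finset.range k, (c + 2 * (j : ℂ))‖ ≤ (2 * R) ^ k * k.factorial := by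
  calc ‖∏ j ∈ Finset.range k, (c + 2 * (j : ℂ))‖
      ≤ ∏ j ∈ Finset.range k, 2 * R * ((j + 1 : ℕ) : ℝ) := by
        rw [norm_prod]
        refine Finset.prod_le_prod (fun _ _ => norm_nonneg _) fun j _ => ?_
        have hj : ‖c + 2 * (j : ℂ)‖ ≤ ‖c‖ + 2 * j := by simpa using norm_add_le c (2 * (j : ℂ))
        push_cast
        nlinarith [Nat.cast_nonneg (α := ℝ) j]
    _ = (2 * R) ^ k * k.factorial := by
        rw [Finset.prod_mul_distrib, Finset.prod_const, Finset.card_range,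
          ← Finset.prod_range_add_one_eq_factorial, Nat.cast_prod]

theorem norm_weberTerm_le {a : ℕ} {c x : ℂ} {R X : ℝ} (hR : 1 ≤ R) (hc : ‖c‖ ≤ R)
    (hx : ‖x‖ ≤ X) (k : ℕ) :
    ‖weberTerm a c x k‖ ≤ X ^ a * ((2 * R * X ^ 2) ^ k / k.factorial) := by
  have hX : 0 ≤ X := (norm_nonneg x).trans hx
  have hfac : (k.factorial : ℝ) * k.factorial ≤ (2 * k + a).factorial := by
    have h :=
      Nat.le_of_dvd (Nat.factorial_pos _) (Nat.factorial_mul_factorial_dvd_factorial_add k k)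
    rw [← two_mul] at h
    exact_mod_cast h.trans (Nat.factorial_le (Nat.le_add_right _ a))
  calc ‖weberTerm a c x k‖
      ≤ (2 * R) ^ k * k.factorial * X ^ (2 * k + a) / (k.factorial * k.factorial) := by
        rw [weberTerm, norm_div, norm_mul, norm_pow, Complex.norm_natCast]
        gcongr
        exact norm_prod_add_two_mul_le hR hc k
    _ = X ^ a * ((2 * R * X ^ 2) ^ k / k.factorial) := by
        rw [mul_pow _ (X ^ 2), ← pow_mul]
        field_simp
        ring

theorem summable_weberTerm (a : ℕ) (c x : ℂ) : Summable (weberTerm a c x) :=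
  .of_norm_bounded ((Real.summable_pow_div_factorial _).mul_left _)
    (norm_weberTerm_le (le_max_left 1 ‖c‖) (le_max_right _ _) le_rfl)

theorem weberSeries_eq_pow_add (a : ℕ) (c x : ℂ) :
    weberSeries a c x = x ^ a / a.factorial + c * weberSeries (a + 2) (c + 2) x := by
  rw [weberSeries, (summable_weberTerm a c x).tsum_eq_zero_add, weberSeries, ← tsum_mul_left]
  congr 1
  · simp [weberTerm]
  · refine tsum_congr fun k => ?_
    have hidx : 2 * (k + 1) + a = 2 * k + (a + 2) := by ring
    rw [weberTerm, weberTerm, ← mul_prod_add_two, hidx]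
    ring

theorem mul_weberSeries (a : ℕ) (c x : ℂ) :
    x * weberSeries a c x =
      (a + 1 - c) * weberSeries (a + 1) c x + c * weberSeries (a + 1) (c + 2) x := by
  simp only [weberSeries, ← tsum_mul_left]
  rw [← ((summable_weberTerm (a + 1) c x).mul_left _).tsum_add
    ((summable_weberTerm (a + 1) (c + 2) x).mul_left c)]
  refine tsum_congr fun k => ?_
  have hprod := mul_prod_add_two c k
  rw [Finset.prod_range_succ] at hprod
  have hfac : ((2 * k + a).factorial : ℂ) ≠ 0 := by exact_mod_cast Nat.factorial_ne_zero _
  have hsucc : (2 * k + a + 1 : ℂ) ≠ 0 := by exact_mod_cast Nat.succ_ne_zero (2 * k + a)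
  simp only [weberTerm, ← add_assoc, Nat.factorial_succ]
  push_cast
  field_simp
  linear_combination -x ^ (2 * k + a + 1) * hprod

theorem weberSeries_zero_add_two (c x : ℂ) :
    weberSeries 0 (c + 2) x = weberSeries 0 c x + x * weberSeries 1 (c + 2) x := by
  have h₁ := weberSeries_eq_pow_add 0 c x
  have h₂ := weberSeries_eq_pow_add 0 (c + 2) x
  have h₃ := mul_weberSeries 1 (c + 2) x
  push_cast at h₃
  linear_combination h₂ - h₁ - h₃

theorem hasDerivAt_weberTerm_succ (a : ℕ) (c x : ℂ) (k : ℕ) :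
    HasDerivAt (fun y => weberTerm (a + 1) c y k) (weberTerm a c x k) x := by
  have h := ((hasDerivAt_pow (2 * k + a + 1) x).const_mul
    (∏ j ∈ Finset.range k, (c + 2 * (j : ℂ)))).div_const ((2 * k + a + 1).factorial : ℂ)
  have hfac : ((2 * k + a).factorial : ℂ) ≠ 0 := by exact_mod_cast Nat.factorial_ne_zero _
  have hsucc : ((2 * k + a + 1 : ℕ) : ℂ) ≠ 0 := by exact_mod_cast Nat.succ_ne_zero (2 * k + a)
  convert! h using 1
  rw [weberTerm, Nat.factorial_succ, Nat.add_sub_cancel, Nat.cast_mul]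
  field_simp

theorem hasDerivAt_weberSeries_succ (a : ℕ) (c x : ℂ) :
    HasDerivAt (weberSeries (a + 1) c) (weberSeries a c x) x :=
  hasDerivAt_tsum_of_isPreconnected
    ((Real.summable_pow_div_factorial _).mul_left _) Metric.isOpen_ball
    (convex_ball (0 : ℂ) (‖x‖ + 1)).isPreconnected (fun k y _ => hasDerivAt_weberTerm_succ a c y k)
    (fun k _ hy => norm_weberTerm_le (le_max_left 1 ‖c‖) (le_max_right _ _)
      (mem_ball_zero_iff.mp hy).le k)
    (mem_ball_zero_iff.mpr (lt_add_one _)) (summable_weberTerm (a + 1) c x)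
    (mem_ball_zero_iff.mpr (lt_add_one _))

theorem hasDerivAt_weberSeries_zero (c x : ℂ) :
    HasDerivAt (weberSeries 0 c) (c * weberSeries 1 (c + 2) x) x := by
  have h := ((hasDerivAt_weberSeries_succ 1 (c + 2) x).const_mul c).const_add 1
  convert! h using 1
  funext y
  simpa using weberSeries_eq_pow_add 0 c y

theorem differentiable_weberSeries (a : ℕ) (x : ℂ) :
    Differentiable ℂ fun c => weberSeries a c x := fun c => by
  have hdiff : DifferentiableOn ℂ (fun d => weberSeries a d x) (Metric.ball 0 (‖c‖ + 1)) :=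
    Complex.differentiableOn_tsum_of_summable_norm
      ((Real.summable_pow_div_factorial _).mul_left _)
      (fun k => by unfold weberTerm; fun_prop) Metric.isOpen_ball
      (fun k _ hd => norm_weberTerm_le (le_add_of_nonneg_left (norm_nonneg c))
        (mem_ball_zero_iff.mp hd).le le_rfl k)
  exact hdiff.differentiableAt
    (Metric.isOpen_ball.mem_nhds (mem_ball_zero_iff.mpr (lt_add_one _)))

theorem weberSeries_neg (a : ℕ) (c x : ℂ) :
    weberSeries a c (-x) = (-1) ^ a * weberSeries a c x := by
  rw [weberSeries, weberSeries, ← tsum_mul_left]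
  refine tsum_congr fun k => ?_
  rw [weberTerm, weberTerm, neg_pow, pow_add, pow_mul, neg_one_sq, one_pow]
  ring

theorem weberSeries_conj (a : ℕ) (c x : ℂ) :
    weberSeries a (conj c) (conj x) = conj (weberSeries a c x) := by
  simp [weberSeries, weberTerm, Complex.conj_tsum, map_ofNat]

/-! ### Parabolic cylinder functions and their Wronskian -/

/-- The value `D_ν(0)` of the parabolic cylinder function at the origin. -/
noncomputable def parabolicDAtZero (ν : ℂ) : ℂ :=
  (2 : ℂ) ^ (ν / 2) * (Real.sqrt Real.pi : ℂ) * (Complex.Gamma (-ν / 2 + 1 / 2))⁻¹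

theorem parabolicDAtZero_add_one (ν : ℂ) :
    parabolicDAtZero (ν + 1) =
      (2 : ℂ) ^ ((ν + 1) / 2) * (Real.sqrt Real.pi : ℂ) * (Complex.Gamma (-ν / 2))⁻¹ := by
  rw [parabolicDAtZero]
  ring_nf

theorem parabolicDAtZero_add_one_eq_mul (ν : ℂ) :
    parabolicDAtZero (ν + 1) = -ν * parabolicDAtZero (ν - 1) := by
  have hpow : (2 : ℂ) ^ ((ν + 1) / 2) = 2 * (2 : ℂ) ^ ((ν - 1) / 2) := by
    rw [show (ν + 1) / 2 = 1 + (ν - 1) / 2 by ring, Complex.cpow_add _ _ two_ne_zero,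
      Complex.cpow_one]
  rw [parabolicDAtZero_add_one, parabolicDAtZero,
    Complex.one_div_Gamma_eq_self_mul_one_div_Gamma_add_one, hpow,
    show -(ν - 1) / 2 + 1 / 2 = -ν / 2 + 1 by ring]
  ring

theorem parabolicD_eq (ν x : ℂ) :
    parabolicD ν x = Complex.exp (-x ^ 2 / 4) * (parabolicDAtZero ν * weberSeries 0 (-ν) x -
      parabolicDAtZero (ν + 1) * weberSeries 1 (-ν + 1) x) := by
  rw [parabolicDAtZero_add_one, parabolicD, yEven, yOdd, parabolicDAtZero]
  simp only [weberSeries, weberTerm, add_zero]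
  ring

theorem parabolicD_add_one (ν x : ℂ) :
    parabolicD (ν + 1) x = x * parabolicD ν x - ν * parabolicD (ν - 1) x := by
  have hd₁ := parabolicDAtZero_add_one_eq_mul ν
  have hd₂ := parabolicDAtZero_add_one_eq_mul (ν + 1)
  have hS₀ := weberSeries_zero_add_two (-(ν + 1)) x
  have hS₁ := mul_weberSeries 0 (-ν) x
  rw [show -(ν + 1) + 2 = -(ν - 1) by ring] at hS₀
  simp only [add_sub_cancel_right, Nat.cast_zero, zero_add] at hd₂ hS₁
  simp only [parabolicD_eq, show -(ν - 1) + 1 = -ν + 2 by ring, sub_add_cancel,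
    show -(ν + 1) + 1 = -ν by ring, show -ν + 1 = -(ν - 1) by ring]
  linear_combination Complex.exp (-x ^ 2 / 4) * (weberSeries 0 (-(ν - 1)) x * hd₁ -
    weberSeries 1 (-ν) x * hd₂ - parabolicDAtZero (ν + 1) * hS₀ - parabolicDAtZero ν * hS₁)

/-- The derivative `D_ν'(x)` of the parabolic cylinder function, given by the recurrence
`D_ν' = ν D_{ν-1} - x D_ν / 2`. -/
noncomputable def parabolicDDeriv (ν x : ℂ) : ℂ :=
  ν * parabolicD (ν - 1) x - x / 2 * parabolicD ν x

theorem hasDerivAt_parabolicD (ν x : ℂ) :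
    HasDerivAt (parabolicD ν) (parabolicDDeriv ν x) x := by
  have hexp : HasDerivAt (fun y : ℂ => Complex.exp (-y ^ 2 / 4))
      (Complex.exp (-x ^ 2 / 4) * (-x / 2)) x := by
    convert! ((hasDerivAt_pow 2 x).neg.div_const 4).cexp using 1
    simp only [Pi.neg_apply]
    push_cast
    ring
  have h := hexp.mul
    (((hasDerivAt_weberSeries_zero (-ν) x).const_mul (parabolicDAtZero ν)).sub
      ((hasDerivAt_weberSeries_succ 0 (-ν + 1) x).const_mul (parabolicDAtZero (ν + 1))))
  convert! h using 1
  · exact funext (parabolicD_eq ν)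
  · have hd := parabolicDAtZero_add_one_eq_mul ν
    simp only [parabolicDDeriv, parabolicD_eq, Pi.sub_apply, sub_add_cancel, zero_add,
      show -(ν - 1) + 1 = -ν + 2 by ring, show -ν + 1 = -(ν - 1) by ring]
    linear_combination Complex.exp (-x ^ 2 / 4) * weberSeries 0 (-(ν - 1)) x * hd

theorem hasDerivAt_parabolicDDeriv (ν x : ℂ) :
    HasDerivAt (parabolicDDeriv ν) ((x ^ 2 / 4 - 1 / 2 - ν) * parabolicD ν x) x := by
  have h := ((hasDerivAt_parabolicD (ν - 1) x).const_mul ν).sub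
    (((hasDerivAt_id x).div_const 2).mul (hasDerivAt_parabolicD ν x))
  convert! h using 1
  have hrec := parabolicD_add_one (ν - 1) x
  rw [sub_add_cancel] at hrec
  simp only [parabolicDDeriv, id]
  linear_combination -ν * hrec

theorem parabolicD_apply_zero (ν : ℂ) : parabolicD ν 0 = parabolicDAtZero ν := by
  have h₀ : weberSeries 0 (-ν) 0 = 1 := by
    rw [weberSeries_eq_pow_add]
    simp [weberSeries, weberTerm]
  have h₁ : weberSeries 1 (-ν + 1) 0 = 0 := by simp [weberSeries, weberTerm]
  simp [parabolicD_eq, h₀, h₁]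

theorem parabolicD_zero (x : ℂ) : parabolicD 0 x = Complex.exp (-x ^ 2 / 4) := by
  have hd : parabolicDAtZero 1 = 0 := by simpa using parabolicDAtZero_add_one_eq_mul 0
  have hd₀ : parabolicDAtZero 0 = 1 := by
    have hpi : (Real.sqrt Real.pi : ℂ) ≠ 0 := by
      exact_mod_cast (Real.sqrt_pos.mpr Real.pi_pos).ne'
    have hsqrt : (Real.pi : ℂ) ^ (1 / 2 : ℂ) = (Real.sqrt Real.pi : ℂ) := by
      rw [Real.sqrt_eq_rpow, Complex.ofReal_cpow Real.pi_pos.le]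
      norm_num
    rw [parabolicDAtZero, neg_zero, zero_div, zero_add, Complex.Gamma_one_half_eq, hsqrt,
      Complex.cpow_zero, one_mul, mul_inv_cancel₀ hpi]
  simp [parabolicD_eq, hd, hd₀, weberSeries_eq_pow_add 0 0 x]

/-- The value of the Wronskian of `D_ν(-x)` and `D_ν(x)`, that is `√(2π) / Γ(-ν)`. -/
noncomputable def weberWronskian (ν : ℂ) : ℂ :=
  (Real.sqrt 2 : ℂ) * (Real.sqrt Real.pi : ℂ) * (Complex.Gamma (-ν))⁻¹

theorem two_cpow_add_one_div_two (ν : ℂ) :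
    (2 : ℂ) ^ ((ν + 1) / 2) = (Real.sqrt 2 : ℂ) * (2 : ℂ) ^ (ν / 2) := by
  have h : (2 : ℂ) ^ (1 / 2 : ℂ) = (Real.sqrt 2 : ℂ) := by
    rw [Real.sqrt_eq_rpow, Complex.ofReal_cpow zero_le_two]
    norm_num
  rw [show (ν + 1) / 2 = 1 / 2 + ν / 2 by ring, Complex.cpow_add _ _ two_ne_zero, h]

/-- This is Legendre's duplication formula. -/
theorem two_mul_parabolicDAtZero_mul (ν : ℂ) :
    2 * parabolicDAtZero ν * parabolicDAtZero (ν + 1) = weberWronskian ν := by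
  have hpi : (Real.sqrt Real.pi : ℂ) ≠ 0 := by
    exact_mod_cast (Real.sqrt_pos.mpr Real.pi_pos).ne'
  have hpow : (2 : ℂ) ^ (ν / 2) ≠ 0 := by simp [Complex.cpow_eq_zero_iff]
  have hsq : (2 : ℂ) ^ (1 - 2 * (-ν / 2)) = 2 * (2 : ℂ) ^ (ν / 2) * (2 : ℂ) ^ (ν / 2) := by
    rw [show 1 - 2 * (-ν / 2) = 1 + ν / 2 + ν / 2 by ring, Complex.cpow_add _ _ two_ne_zero,
      Complex.cpow_add _ _ two_ne_zero, Complex.cpow_one]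
  have hdup : (Complex.Gamma (-ν / 2))⁻¹ * (Complex.Gamma (-ν / 2 + 1 / 2))⁻¹ =
      (Complex.Gamma (-ν))⁻¹ *
        (2 * (2 : ℂ) ^ (ν / 2) * (2 : ℂ) ^ (ν / 2) * (Real.sqrt Real.pi : ℂ))⁻¹ := by
    rw [← mul_inv, Complex.Gamma_mul_Gamma_add_half, hsq, mul_div_cancel₀ _ two_ne_zero, mul_assoc,
      mul_inv]
  rw [parabolicDAtZero_add_one, parabolicDAtZero, two_cpow_add_one_div_two, weberWronskian]
  calc _ = 2 * (2 : ℂ) ^ (ν / 2) * (2 : ℂ) ^ (ν / 2) * (Real.sqrt 2 : ℂ) *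
        (Real.sqrt Real.pi : ℂ) ^ 2 *
        ((Complex.Gamma (-ν / 2))⁻¹ * (Complex.Gamma (-ν / 2 + 1 / 2))⁻¹) := by ring
    _ = _ := by
      rw [hdup]
      generalize (Complex.Gamma (-ν))⁻¹ = g
      field_simp

theorem wronskian_parabolicD (ν x : ℂ) :
    -(parabolicD ν x * parabolicDDeriv ν (-x) + parabolicDDeriv ν x * parabolicD ν (-x)) =
      weberWronskian ν := by
  have hderiv : ∀ x : ℂ, HasDerivAt (fun x => -(parabolicD ν x * parabolicDDeriv ν (-x) +
      parabolicDDeriv ν x * parabolicD ν (-x))) 0 x := fun x => by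
    have h₁ := (hasDerivAt_parabolicD ν (-x)).comp x (hasDerivAt_neg x)
    have h₂ := (hasDerivAt_parabolicDDeriv ν (-x)).comp x (hasDerivAt_neg x)
    convert! (((hasDerivAt_parabolicD ν x).mul h₂).add
      ((hasDerivAt_parabolicDDeriv ν x).mul h₁)).neg using 1
    simp only [Function.comp]
    ring
  refine (is_const_of_deriv_eq_zero (fun x => (hderiv x).differentiableAt)
    (fun x => (hderiv x).deriv) x 0).trans ?_
  simp only [parabolicDDeriv, neg_zero, parabolicD_apply_zero, ← two_mul_parabolicDAtZero_mul,
    parabolicDAtZero_add_one_eq_mul]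
  ring

theorem weberWronskian_ne_zero {ν : ℂ} (hν : ∀ n : ℕ, ν ≠ n) : weberWronskian ν ≠ 0 := by
  have hpi : Real.sqrt Real.pi ≠ 0 := (Real.sqrt_pos.mpr Real.pi_pos).ne'
  exact mul_ne_zero (by simp [hpi]) (inv_ne_zero
    (Complex.Gamma_ne_zero fun n h => hν n (neg_injective h)))

theorem differentiable_weberWronskian : Differentiable ℂ weberWronskian :=
  (Complex.differentiable_one_div_Gamma.comp differentiable_neg).const_mul _

theorem weberWronskian_conj (ν : ℂ) : weberWronskian (conj ν) = conj (weberWronskian ν) := by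
  simp [weberWronskian, ← map_neg, Complex.Gamma_conj]

theorem differentiable_parabolicDAtZero : Differentiable ℂ parabolicDAtZero :=
  ((((differentiable_id.div_const 2).const_cpow (Or.inl two_ne_zero)).mul_const _).mul
    (Complex.differentiable_one_div_Gamma.comp (g := fun s => (Complex.Gamma s)⁻¹) (by fun_prop)))

theorem differentiable_parabolicD_index (x : ℂ) : Differentiable ℂ fun ν => parabolicD ν x := by
  simp only [parabolicD_eq]
  exact ((differentiable_parabolicDAtZero.mul
    ((differentiable_weberSeries 0 x).comp (by fun_prop))).sub
      ((differentiable_parabolicDAtZero.comp (by fun_prop)).mul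
        ((differentiable_weberSeries 1 x).comp (by fun_prop)))).const_mul _

theorem parabolicDAtZero_conj (ν : ℂ) :
    parabolicDAtZero (conj ν) = conj (parabolicDAtZero ν) := by
  have harg : Complex.arg 2 ≠ Real.pi := by
    simpa using (Complex.natCast_arg (n := 2)).trans_ne Real.pi_ne_zero.symm
  simp only [parabolicDAtZero, map_mul, map_inv₀, Complex.conj_ofReal, ← Complex.Gamma_conj]
  have hpow := Complex.cpow_conj 2 (ν / 2) harg
  simp_all [map_ofNat]

theorem parabolicD_conj (ν x : ℂ) :
    parabolicD (conj ν) (conj x) = conj (parabolicD ν x) := by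
  have h₁ : conj ν + 1 = conj (ν + 1) := by simp
  have h₂ : -conj ν = conj (-ν) := by simp
  have h₃ : conj (-ν) + 1 = conj (-ν + 1) := by simp
  simp only [parabolicD_eq, h₁, h₂, h₃, parabolicDAtZero_conj, weberSeries_conj]
  simp [← Complex.exp_conj, map_ofNat]

/-! ### Integral representation and decay -/

/-- The Mellin transform at `s` of the tilted Gaussian `t ↦ e^{-t²/2 + x t}`, that is
`∫₀^∞ t^{s-1} e^{-t²/2 + x t} dt`. It represents `D_{-s}(-x)` for `re s > 0`. -/
noncomputable def gaussianMellin (x s : ℂ) : ℂ :=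
  mellin (fun t : ℝ => Complex.exp (-t ^ 2 / 2 + x * t)) s

theorem gaussianMellin_zero {s : ℂ} (hs : 0 < s.re) :
    gaussianMellin 0 s = (2 : ℂ) ^ (s / 2) / 2 * Complex.Gamma (s / 2) := by
  have hsubst : ∀ t : ℝ, Complex.exp (-t ^ 2 / 2 + 0 * t) =
      Complex.exp (-(((1 / 2 : ℝ) : ℂ) * ((t ^ (2 : ℝ) : ℝ) : ℂ))) := fun t => by
    rw [Real.rpow_two]
    congr 1
    push_cast
    ring
  have hs' : 0 < (s / 2).re := by simpa using hs
  have hGamma := Complex.integral_cpow_mul_exp_neg_mul_Ioi hs' (r := 1 / 2) (by norm_num)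
  simp only [gaussianMellin, hsubst]
  rw [mellin_comp_rpow (fun t : ℝ => Complex.exp (-(((1 / 2 : ℝ) : ℂ) * t))) s 2, mellin]
  simp only [smul_eq_mul, Complex.ofReal_ofNat, Complex.real_smul]
  rw [hGamma]
  norm_num
  ring

theorem gaussianMellin_zero_add_two {s : ℂ} (hs : 0 < s.re) :
    gaussianMellin 0 (s + 2) = s * gaussianMellin 0 s := by
  have hs' : 0 < (s + 2).re := by simp; linarith
  have hne : s / 2 ≠ 0 := by
    rintro h
    simp_all
  rw [gaussianMellin_zero hs, gaussianMellin_zero hs', show (s + 2) / 2 = s / 2 + 1 by ring,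
    Complex.Gamma_add_one _ hne, Complex.cpow_add _ _ two_ne_zero, Complex.cpow_one]
  ring

theorem gaussianMellin_zero_add_two_mul {s : ℂ} (hs : 0 < s.re) (k : ℕ) :
    gaussianMellin 0 (s + 2 * k) =
      (∏ j ∈ Finset.range k, (s + 2 * (j : ℂ))) * gaussianMellin 0 s := by
  induction k with
  | zero => simp
  | succ k ih =>
    have hs' : 0 < (s + 2 * (k : ℂ)).re := by
      simp only [Complex.add_re, Complex.mul_re, Complex.re_ofNat, Complex.natCast_re,
        Complex.im_ofNat, zero_mul, sub_zero]
      positivity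
    rw [Finset.prod_range_succ, Nat.cast_succ, mul_add, mul_one, ← add_assoc,
      gaussianMellin_zero_add_two hs', ih]
    ring

theorem norm_cpow_smul_exp_gaussian {t : ℝ} (ht : 0 < t) (s x : ℂ) :
    ‖(t : ℂ) ^ (s - 1) • Complex.exp (-t ^ 2 / 2 + x * t)‖ =
      t ^ (s.re - 1) * Real.exp (-t ^ 2 / 2 + x.re * t) := by
  rw [norm_smul, Complex.norm_cpow_eq_rpow_re_of_pos ht, Complex.norm_exp]
  congr 2
  rw [Complex.add_re, Complex.re_mul_ofReal]
  norm_cast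

theorem integrableOn_rpow_mul_exp_gaussian {σ : ℝ} (hσ : 0 < σ) (y : ℝ) :
    IntegrableOn (fun t : ℝ => t ^ (σ - 1) * Real.exp (-t ^ 2 / 2 + y * t)) (Ioi 0) := by
  have hdom := (integrableOn_rpow_mul_exp_neg_mul_sq (b := 1 / 4) (by norm_num)
    (s := σ - 1) (by linarith)).mul_const (Real.exp (y ^ 2))
  refine hdom.mono' (ContinuousOn.aestronglyMeasurable ?_ measurableSet_Ioi) ?_
  · exact (continuousOn_id.rpow_const fun t ht => Or.inl (ne_of_gt ht)).mul (by fun_prop)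
  · filter_upwards [ae_restrict_mem measurableSet_Ioi] with t (ht : 0 < t)
    rw [Real.norm_of_nonneg (by positivity), mul_assoc, ← Real.exp_add]
    refine mul_le_mul_of_nonneg_left (Real.exp_le_exp.mpr ?_) (by positivity)
    nlinarith [sq_nonneg (y - t / 2)]

theorem hasSum_gaussianMellin {s : ℂ} (hs : 0 < s.re) (x : ℂ) :
    HasSum (fun n : ℕ => x ^ n / n.factorial * gaussianMellin 0 (s + n)) (gaussianMellin x s) := by
  have hterm : ∀ (n : ℕ) (t : ℝ), 0 < t →
      x ^ n / n.factorial * ((t : ℂ) ^ (s + n - 1) • Complex.exp (-t ^ 2 / 2 + 0 * t)) =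
        (t : ℂ) ^ (s - 1) • Complex.exp (-t ^ 2 / 2 + 0 * t) * ((x * t) ^ n / n.factorial) :=
    fun n t ht => by
      rw [add_sub_right_comm, Complex.cpow_add _ _ (by exact_mod_cast ht.ne'),
        Complex.cpow_natCast, mul_pow, smul_eq_mul, smul_eq_mul]
      ring
  simp only [gaussianMellin, mellin, ← integral_const_mul]
  refine hasSum_integral_of_dominated_convergence
    (fun n t => t ^ (s.re - 1) * Real.exp (-t ^ 2 / 2) * ((‖x‖ * t) ^ n / n.factorial))
    (fun n => ?_) (fun n => ?_) ?_ ?_ ?_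
  · refine ContinuousOn.aestronglyMeasurable (fun t ht => ?_) measurableSet_Ioi
    exact (continuousAt_const.mul ((Complex.continuousAt_ofReal_cpow_const t _
      (Or.inr (ne_of_gt ht))).smul (by fun_prop))).continuousWithinAt
  · filter_upwards [ae_restrict_mem measurableSet_Ioi] with t (ht : 0 < t)
    rw [hterm n t ht, norm_mul, norm_cpow_smul_exp_gaussian ht]
    simp [abs_of_pos ht]
  · exact ae_of_all _ fun t => (Real.summable_pow_div_factorial _).mul_left _
  · simp only [tsum_mul_left, ← congrFun NormedSpace.exp_eq_tsum_div, ← Real.exp_eq_exp_ℝ,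
      mul_assoc, ← Real.exp_add]
    exact integrableOn_rpow_mul_exp_gaussian hs ‖x‖
  · filter_upwards [ae_restrict_mem measurableSet_Ioi] with t ht
    simp only [hterm _ t ht]
    rw [zero_mul, add_zero, Complex.exp_add, ← smul_mul_assoc, Complex.exp_eq_exp_ℂ]
    exact (NormedSpace.expSeries_div_hasSum_exp (x * t : ℂ)).mul_left _

theorem gaussianMellin_eq_weberSeries {s : ℂ} (hs : 0 < s.re) (x : ℂ) :
    gaussianMellin x s = gaussianMellin 0 s * weberSeries 0 s x +
      gaussianMellin 0 (s + 1) * weberSeries 1 (s + 1) x := by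
  have hs' : 0 < (s + 1).re := by simp; linarith
  refine (hasSum_gaussianMellin hs x).unique (HasSum.even_add_odd ?_ ?_)
  · convert! (summable_weberTerm 0 s x).hasSum.mul_left (gaussianMellin 0 s) using 2 with k
    rw [Nat.cast_mul, Nat.cast_ofNat, gaussianMellin_zero_add_two_mul hs, weberTerm, add_zero]
    ring
  · convert! (summable_weberTerm 1 (s + 1) x).hasSum.mul_left (gaussianMellin 0 (s + 1))
      using 2 with k
    rw [Nat.cast_succ, Nat.cast_mul, Nat.cast_ofNat, add_comm _ (1 : ℂ), ← add_assoc,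
      gaussianMellin_zero_add_two_mul hs', weberTerm]
    ring

theorem gaussianMellin_mul_parabolicDAtZero {s : ℂ} (hs : 0 < s.re) :
    Real.sqrt 2 * (gaussianMellin 0 s * parabolicDAtZero (-s + 1)) = Real.sqrt Real.pi := by
  have hsqrt : (Real.sqrt 2 : ℂ) * Real.sqrt 2 = 2 := by
    exact_mod_cast Real.mul_self_sqrt zero_le_two
  have hpow : (2 : ℂ) ^ (s / 2) * (2 : ℂ) ^ (-s / 2) = 1 := by
    rw [← Complex.cpow_add _ _ two_ne_zero, neg_div, add_neg_cancel, Complex.cpow_zero]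
  have hGamma : Complex.Gamma (s / 2) ≠ 0 :=
    Complex.Gamma_ne_zero_of_re_pos (by simpa using hs)
  rw [gaussianMellin_zero hs, parabolicDAtZero_add_one, two_cpow_add_one_div_two, neg_neg]
  calc _ = (Real.sqrt 2 : ℂ) * Real.sqrt 2 / 2 * ((2 : ℂ) ^ (s / 2) * (2 : ℂ) ^ (-s / 2)) *
        (Complex.Gamma (s / 2) * (Complex.Gamma (s / 2))⁻¹) * Real.sqrt Real.pi := by ring
    _ = _ := by rw [hsqrt, hpow, mul_inv_cancel₀ hGamma]; norm_num

theorem parabolicD_eq_gaussianMellin {ν : ℂ} (hν : ν.re < 0) (x : ℂ) :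
    parabolicD ν x =
      (Complex.Gamma (-ν))⁻¹ * (Complex.exp (-x ^ 2 / 4) * gaussianMellin (-x) (-ν)) := by
  have hs : 0 < (-ν).re := by simpa using hν
  have hs' : 0 < (-ν + 1).re := by simp at hs ⊢; linarith
  have hsqrt : (Real.sqrt 2 : ℂ) * Real.sqrt 2 = 2 := by
    exact_mod_cast Real.mul_self_sqrt zero_le_two
  have hpi : (Real.sqrt Real.pi : ℂ) ≠ 0 := by
    exact_mod_cast (Real.sqrt_pos.mpr Real.pi_pos).ne'
  have hW := two_mul_parabolicDAtZero_mul ν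
  have hM₀ := gaussianMellin_mul_parabolicDAtZero hs
  have hM₁ := gaussianMellin_mul_parabolicDAtZero hs'
  rw [neg_neg] at hM₀
  rw [neg_add, neg_neg, neg_add_cancel_right] at hM₁
  rw [weberWronskian] at hW
  have hd₀ : parabolicDAtZero ν = (Complex.Gamma (-ν))⁻¹ * gaussianMellin 0 (-ν) := by
    refine mul_right_cancel₀ hpi ?_
    linear_combination (-parabolicDAtZero ν) * hM₀ + Real.sqrt 2 * gaussianMellin 0 (-ν) / 2 * hW +
      (Complex.Gamma (-ν))⁻¹ * gaussianMellin 0 (-ν) * Real.sqrt Real.pi / 2 * hsqrt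
  have hd₁ : parabolicDAtZero (ν + 1) = (Complex.Gamma (-ν))⁻¹ * gaussianMellin 0 (-ν + 1) := by
    refine mul_right_cancel₀ hpi ?_
    linear_combination (-parabolicDAtZero (ν + 1)) * hM₁ +
      Real.sqrt 2 * gaussianMellin 0 (-ν + 1) / 2 * hW +
      (Complex.Gamma (-ν))⁻¹ * gaussianMellin 0 (-ν + 1) * Real.sqrt Real.pi / 2 * hsqrt
  rw [parabolicD_eq, gaussianMellin_eq_weberSeries hs, weberSeries_neg, weberSeries_neg, hd₀, hd₁]
  ring

/-- Decay at `+∞` faster than every exponential `e^{-cx}`. -/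
def SuperexpDecay (f : ℝ → ℂ) : Prop :=
  ∀ c : ℝ, f =O[atTop] fun x => Real.exp (-c * x)

namespace SuperexpDecay

variable {f g : ℝ → ℂ}

theorem sub (hf : SuperexpDecay f) (hg : SuperexpDecay g) : SuperexpDecay fun x => f x - g x :=
  fun c => (hf c).sub (hg c)

theorem const_mul (hf : SuperexpDecay f) (a : ℂ) : SuperexpDecay fun x => a * f x :=
  fun c => (hf c).const_mul_left a

theorem ofReal_mul (hf : SuperexpDecay f) : SuperexpDecay fun x => (x : ℂ) * f x := fun c => by
  have hid : (fun x : ℝ => (x : ℂ)) =O[atTop] fun x : ℝ => Real.exp x := by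
    refine .of_bound 1 (eventually_ge_atTop 0 |>.mono fun x hx => ?_)
    rw [Complex.norm_real, Real.norm_of_nonneg hx, Real.norm_of_nonneg (Real.exp_nonneg x), one_mul]
    linarith [Real.add_one_le_exp x]
  refine (hid.mul (hf (c + 1))).congr_right fun x => ?_
  rw [← Real.exp_add]
  ring_nf

theorem memLp_Ioi (hf : SuperexpDecay f) (hcont : Continuous f) (s : ℝ) :
    MemLp f 2 (volume.restrict (Ioi s)) := by
  rw [memLp_two_iff_integrable_sq_norm hcont.aestronglyMeasurable]
  refine integrable_of_isBigO_exp_neg (b := 2) two_pos (by fun_prop) ?_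
  refine ((hf 1).norm_left.pow 2).congr_right fun x => ?_
  rw [← Real.exp_nat_mul]
  ring_nf

end SuperexpDecay

theorem norm_gaussianMellin_le {s x : ℂ} (hs : 0 < s.re) (hx : x.re ≤ 0) :
    ‖gaussianMellin x s‖ ≤ ∫ t in Ioi (0 : ℝ), t ^ (s.re - 1) * Real.exp (-t ^ 2 / 2) := by
  refine norm_integral_le_of_norm_le
    (by simpa using (integrableOn_rpow_mul_exp_gaussian hs 0).integrable) ?_
  filter_upwards [ae_restrict_mem measurableSet_Ioi] with t (ht : 0 < t)
  rw [norm_cpow_smul_exp_gaussian ht]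
  gcongr
  exact add_le_of_nonpos_right (mul_nonpos_of_nonpos_of_nonneg hx ht.le)

theorem superexpDecay_parabolicD_of_re_neg {ν : ℂ} (hν : ν.re < 0) :
    SuperexpDecay fun x => parabolicD ν x := fun c => by
  have hs : 0 < (-ν).re := by simpa using hν
  refine .of_bound (‖(Complex.Gamma (-ν))⁻¹‖ * (Real.exp (c ^ 2) *
    ∫ t in Ioi (0 : ℝ), t ^ ((-ν).re - 1) * Real.exp (-t ^ 2 / 2))) ?_
  filter_upwards [eventually_ge_atTop 0] with x hx
  have hgauss : ‖Complex.exp (-x ^ 2 / 4)‖ ≤ Real.exp (c ^ 2) * Real.exp (-c * x) := by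
    rw [← Real.exp_add, show (-x ^ 2 / 4 : ℂ) = ((-x ^ 2 / 4 : ℝ) : ℂ) by push_cast; rfl,
      Complex.norm_exp_ofReal]
    gcongr
    nlinarith [sq_nonneg (x / 2 - c)]
  rw [parabolicD_eq_gaussianMellin hν, norm_mul, norm_mul, Real.norm_of_nonneg (Real.exp_nonneg _)]
  have hM := norm_gaussianMellin_le hs (x := -x) (by simpa using hx)
  refine (mul_le_mul_of_nonneg_left (mul_le_mul hgauss hM (norm_nonneg _) (by positivity))
    (norm_nonneg _)).trans_eq ?_
  ring

theorem superexpDecay_parabolicD (ν : ℂ) : SuperexpDecay fun x => parabolicD ν x := by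
  obtain ⟨n, hn⟩ := exists_nat_gt ν.re
  induction n generalizing ν with
  | zero => exact superexpDecay_parabolicD_of_re_neg (by simpa using hn)
  | succ n ih =>
    have h₁ := ih (ν - 1) (by push_cast at hn; simp; linarith)
    have h₂ := ih (ν - 1 - 1) (by push_cast at hn; simp; linarith)
    have hrec : ∀ x : ℂ, parabolicD ν x =
        x * parabolicD (ν - 1) x - (ν - 1) * parabolicD (ν - 1 - 1) x := fun x => by
      simpa using parabolicD_add_one (ν - 1) x
    simpa only [hrec] using h₁.ofReal_mul.sub (h₂.const_mul (ν - 1))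

theorem superexpDecay_parabolicDDeriv (ν : ℂ) : SuperexpDecay fun x => parabolicDDeriv ν x := by
  have h := ((superexpDecay_parabolicD (ν - 1)).const_mul ν).sub
    ((superexpDecay_parabolicD ν).ofReal_mul.const_mul (1 / 2))
  convert! h using 2 with x
  rw [parabolicDDeriv]
  ring

/-! ### Weak derivatives -/

/-- The smooth step rising from `0` at `a` to `1` at `a + ε`, for `0 < ε`. Differences of such steps
are the test functions that localize a weak derivative to an interval. -/
noncomputable def smoothStep (a ε t : ℝ) : ℂ := (Real.smoothTransition ((t - a) / ε) : ℂ)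

theorem contDiff_smoothStep (a ε : ℝ) : ContDiff ℝ ∞ (smoothStep a ε) :=
  Complex.ofRealCLM.contDiff.comp
    (Real.smoothTransition.contDiff.comp ((contDiff_id.sub contDiff_const).div_const ε))

theorem smoothStep_of_le {a ε t : ℝ} (hε : 0 ≤ ε) (ht : t ≤ a) : smoothStep a ε t = 0 := by
  rw [smoothStep, Real.smoothTransition.zero_of_nonpos, Complex.ofReal_zero]
  exact div_nonpos_of_nonpos_of_nonneg (sub_nonpos.mpr ht) hε

theorem smoothStep_of_add_le {a ε t : ℝ} (hε : 0 < ε) (ht : a + ε ≤ t) : smoothStep a ε t = 1 := by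
  rw [smoothStep, Real.smoothTransition.one_of_one_le, Complex.ofReal_one]
  rw [one_le_div hε]
  linarith

theorem norm_smoothStep_le_one (a ε t : ℝ) : ‖smoothStep a ε t‖ ≤ 1 := by
  rw [smoothStep, Complex.norm_real, Real.norm_of_nonneg (Real.smoothTransition.nonneg _)]
  exact Real.smoothTransition.le_one _

theorem tendsto_smoothStep (a t : ℝ) :
    Tendsto (fun ε => smoothStep a ε t) (𝓝[>] 0) (𝓝 ((Ioi a).indicator 1 t)) := by
  rcases le_or_gt t a with ht | ht
  · rw [indicator_of_notMem (notMem_Ioi.mpr ht)]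
    exact tendsto_const_nhds.congr' <|
      eventually_mem_nhdsWithin.mono fun ε hε => (smoothStep_of_le (le_of_lt hε) ht).symm
  · rw [indicator_of_mem (mem_Ioi.mpr ht), Pi.one_apply]
    refine tendsto_const_nhds.congr' ?_
    filter_upwards [Ioc_mem_nhdsGT (sub_pos.mpr ht)] with ε hε
    exact (smoothStep_of_add_le hε.1 (by linarith [hε.2])).symm

theorem hasDerivAt_smoothStep (a ε t : ℝ) :
    HasDerivAt (smoothStep a ε) (deriv (smoothStep 0 1) ((t - a) / ε) / ε) t := by
  have hunit : HasDerivAt (smoothStep 0 1) _ ((t - a) / ε) :=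
    ((contDiff_smoothStep 0 1).differentiable (by simp) _).hasDerivAt
  convert! hunit.scomp t (((hasDerivAt_id t).sub_const a).div_const ε) using 1
  · ext x
    simp [smoothStep]
  · rw [Complex.real_smul, Complex.ofReal_div, Complex.ofReal_one]
    ring

theorem deriv_smoothStep_eq_zero {t : ℝ} (ht : t ∉ Icc (0 : ℝ) 1) :
    deriv (smoothStep 0 1) t = 0 := by
  rcases lt_or_ge t 0 with h | h
  · have hconst : smoothStep 0 1 =ᶠ[𝓝 t] fun _ => 0 :=
      (eventually_lt_nhds h).mono fun x hx => smoothStep_of_le zero_le_one hx.le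
    rw [hconst.deriv_eq, deriv_const]
  · have hconst : smoothStep 0 1 =ᶠ[𝓝 t] fun _ => 1 :=
      (eventually_gt_nhds (not_le.mp fun h' => ht ⟨h, h'⟩)).mono fun x hx =>
        smoothStep_of_add_le one_pos (by linarith)
    rw [hconst.deriv_eq, deriv_const]

theorem tendsto_integral_mul_deriv_smoothStep {f : ℝ → ℂ} (hf : Continuous f) (a : ℝ) :
    Tendsto (fun ε => ∫ t, f t * deriv (smoothStep a ε) t) (𝓝[>] 0) (𝓝 (f a)) := by
  have hstep : Continuous (deriv (smoothStep 0 1)) :=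
    (contDiff_smoothStep 0 1).continuous_deriv (by simp)
  have hrescale : ∀ ε ∈ Ioi (0 : ℝ), ∫ s in (0 : ℝ)..1, f (a + ε * s) * deriv (smoothStep 0 1) s =
      ∫ t, f t * deriv (smoothStep a ε) t := fun ε (hε : 0 < ε) => by
    have hsupp : ∀ s ∉ Icc (0 : ℝ) 1, f (a + ε * s) * deriv (smoothStep 0 1) s = 0 :=
      fun s hs => by rw [deriv_smoothStep_eq_zero hs, mul_zero]
    rw [intervalIntegral.integral_of_le zero_le_one, ← integral_Icc_eq_integral_Ioc,
      setIntegral_eq_integral_of_forall_compl_eq_zero hsupp,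
      ← integral_add_left_eq_self (fun t => f t * _) a]
    have hscale := Measure.integral_comp_mul_left
      (fun t => f (a + t) * deriv (smoothStep a ε) (a + t)) ε
    rw [abs_of_pos (inv_pos.mpr hε), eq_inv_smul_iff₀ hε.ne', ← integral_smul] at hscale
    rw [← hscale]
    congr with s
    have hε' : (ε : ℂ) ≠ 0 := by exact_mod_cast hε.ne'
    rw [(hasDerivAt_smoothStep a ε _).deriv, add_sub_cancel_left, mul_div_cancel_left₀ _ hε.ne',
      Complex.real_smul]
    field_simp
  have hcont : Continuous fun ε : ℝ =>
      ∫ s in (0 : ℝ)..1, f (a + ε * s) * deriv (smoothStep 0 1) s :=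
    intervalIntegral.continuous_parametric_intervalIntegral_of_continuous' (by fun_prop) _ _
  have hzero : ∫ s in (0 : ℝ)..1, f (a + 0 * s) * deriv (smoothStep 0 1) s = f a := by
    simp only [zero_mul, add_zero]
    rw [intervalIntegral.integral_const_mul, intervalIntegral.integral_deriv_eq_sub
      (fun x _ => (contDiff_smoothStep 0 1).differentiable (by simp) x)
      (hstep.intervalIntegrable _ _),
      smoothStep_of_add_le one_pos (by norm_num), smoothStep_of_le zero_le_one le_rfl, sub_zero,
      mul_one]
  have hlim := (hcont.tendsto 0).mono_left (nhdsWithin_le_nhds (s := Ioi 0))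
  rw [hzero] at hlim
  exact hlim.congr' (eventually_mem_nhdsWithin.mono hrescale)

theorem smoothStep_sub_smoothStep_eq_zero {a b ε t : ℝ} (hab : a ≤ b) (hε : ε ∈ Ioc (0 : ℝ) 1)
    (ht : t ∉ Icc a (b + 1)) : smoothStep a ε t - smoothStep b ε t = 0 := by
  rcases lt_or_ge t a with h | h
  · rw [smoothStep_of_le hε.1.le h.le, smoothStep_of_le hε.1.le (h.le.trans hab), sub_self]
  · have hbt : b + 1 < t := not_le.mp fun h' => ht ⟨h, h'⟩
    rw [smoothStep_of_add_le hε.1 (by linarith [hε.2]),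
      smoothStep_of_add_le hε.1 (by linarith [hε.2]), sub_self]

theorem integrable_mul_deriv_smoothStep {f : ℝ → ℂ} (hf : Continuous f) (a : ℝ) {ε : ℝ}
    (hε : 0 < ε) : Integrable fun t => f t * deriv (smoothStep a ε) t := by
  have hcont := hf.mul ((contDiff_smoothStep a ε).continuous_deriv (by simp))
  refine hcont.integrable_of_hasCompactSupport
    (.intro (isCompact_Icc (a := a) (b := a + ε)) fun t ht => ?_)
  rw [Pi.mul_apply, (hasDerivAt_smoothStep a ε t).deriv, deriv_smoothStep_eq_zero, zero_div,
    mul_zero]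
  rwa [mem_Icc, le_div_iff₀ hε, div_le_one hε, zero_mul, sub_nonneg, sub_le_iff_le_add', ← mem_Icc]

theorem tendsto_integral_mul_smoothStep_sub {f : ℝ → ℂ} (hf : LocallyIntegrable f) {a b : ℝ}
    (hab : a ≤ b) : Tendsto (fun ε => ∫ t, f t * (smoothStep a ε t - smoothStep b ε t)) (𝓝[>] 0)
      (𝓝 (∫ t in a..b, f t)) := by
  have hlim : ∫ t in a..b, f t =
      ∫ t, f t * ((Ioi a).indicator 1 t - (Ioi b).indicator 1 t) := by
    rw [intervalIntegral.integral_of_le hab, ← integral_indicator measurableSet_Ioc]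
    congr with t
    rw [← Pi.sub_apply, ← indicator_sdiff (Ioi_subset_Ioi hab), Ioi_sdiff_Ioi]
    simp [indicator_apply]
  have hmeas : ∀ ε, AEStronglyMeasurable fun t => f t * (smoothStep a ε t - smoothStep b ε t) :=
    fun ε => hf.aestronglyMeasurable.mul ((contDiff_smoothStep a ε).continuous.sub
      (contDiff_smoothStep b ε).continuous).aestronglyMeasurable
  have hbound : Integrable ((Icc a (b + 1)).indicator fun t => ‖f t‖ * 2) :=
    (integrable_indicator_iff measurableSet_Icc).mpr
      ((hf.integrableOn_isCompact isCompact_Icc).norm.mul_const 2)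
  rw [hlim]
  refine tendsto_integral_filter_of_dominated_convergence _ (.of_forall hmeas) ?_ hbound
    (ae_of_all _ fun t => ((tendsto_smoothStep a t).sub (tendsto_smoothStep b t)).const_mul _)
  filter_upwards [Ioc_mem_nhdsGT one_pos] with ε hε
  refine ae_of_all _ fun t => ?_
  by_cases ht : t ∈ Icc a (b + 1)
  · rw [indicator_of_mem ht, norm_mul, ← one_add_one_eq_two]
    exact mul_le_mul_of_nonneg_left ((norm_sub_le _ _).trans
      (add_le_add (norm_smoothStep_le_one a ε t) (norm_smoothStep_le_one b ε t))) (norm_nonneg _)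
  · rw [smoothStep_sub_smoothStep_eq_zero hab hε ht, mul_zero, norm_zero, indicator_of_notMem ht]

theorem deriv_conj (f : ℝ → ℂ) (x : ℝ) : deriv (fun x => conj (f x)) x = conj (deriv f x) :=
  deriv.star

namespace IsWeakDeriv

variable {f f' : ℝ → ℂ}

theorem integral_eq_sub (h : IsWeakDeriv f f') (hf : Continuous f)
    (hf' : LocallyIntegrable f') {a b : ℝ} (hab : a ≤ b) : ∫ t in a..b, f' t = f b - f a := by
  refine tendsto_nhds_unique (tendsto_integral_mul_smoothStep_sub hf' hab) <|
    ((tendsto_integral_mul_deriv_smoothStep hf b).sub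
      (tendsto_integral_mul_deriv_smoothStep hf a)).congr' ?_
  filter_upwards [Ioc_mem_nhdsGT one_pos] with ε hε
  have htest := h (fun t => smoothStep a ε t - smoothStep b ε t)
    ((contDiff_smoothStep a ε).sub (contDiff_smoothStep b ε))
    (.intro isCompact_Icc fun t => smoothStep_sub_smoothStep_eq_zero hab hε)
  have hderiv : ∀ t, f t * deriv (fun t => smoothStep a ε t - smoothStep b ε t) t =
      f t * deriv (smoothStep a ε) t - f t * deriv (smoothStep b ε) t := fun t => by
    rw [deriv_fun_sub (hasDerivAt_smoothStep a ε t).differentiableAt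
      (hasDerivAt_smoothStep b ε t).differentiableAt, mul_sub]
  simp only [hderiv] at htest
  rw [integral_sub (integrable_mul_deriv_smoothStep hf a hε.1)
    (integrable_mul_deriv_smoothStep hf b hε.1)] at htest
  linear_combination -htest

theorem integral_Ioi (h : IsWeakDeriv f f') (hf : Continuous f) (hf' : LocallyIntegrable f')
    {s : ℝ} (hint : IntegrableOn f (Ioi s)) (hint' : IntegrableOn f' (Ioi s)) :
    ∫ x in Ioi s, f' x = -f s := by
  have hlim : Tendsto f atTop (𝓝 (f s + ∫ x in Ioi s, f' x)) := by
    refine ((intervalIntegral_tendsto_integral_Ioi s hint' tendsto_id).const_add (f s)).congr' ?_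
    filter_upwards [eventually_ge_atTop s] with x hx
    rw [id, h.integral_eq_sub hf hf' hx, add_sub_cancel]
  have hzero := IntegrableAtFilter.eq_zero_of_tendsto ⟨Ioi s, Ioi_mem_atTop s, hint⟩
    (fun t ht => by
      obtain ⟨x, hx⟩ := mem_atTop_sets.mp ht
      exact measure_mono_top hx Real.volume_Ici) hlim
  exact eq_neg_of_add_eq_zero_right hzero

theorem integral_Iic (h : IsWeakDeriv f f') (hf : Continuous f) (hf' : LocallyIntegrable f')
    {s : ℝ} (hint : IntegrableOn f (Iic s)) (hint' : IntegrableOn f' (Iic s)) :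
    ∫ x in Iic s, f' x = f s := by
  have hlim : Tendsto f atBot (𝓝 (f s - ∫ x in Iic s, f' x)) := by
    refine ((intervalIntegral_tendsto_integral_Iic s hint' tendsto_id).const_sub (f s)).congr' ?_
    filter_upwards [eventually_le_atBot s] with x hx
    rw [id, h.integral_eq_sub hf hf' hx, sub_sub_cancel]
  have hzero := IntegrableAtFilter.eq_zero_of_tendsto ⟨Iic s, Iic_mem_atBot s, hint⟩
    (fun t ht => by
      obtain ⟨x, hx⟩ := mem_atBot_sets.mp ht
      exact measure_mono_top hx Real.volume_Iic) hlim
  exact (sub_eq_zero.mp hzero).symm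

theorem mul_contDiff (h : IsWeakDeriv f f') (hf : LocallyIntegrable f)
    (hf' : LocallyIntegrable f') {u : ℝ → ℂ} (hu : ContDiff ℝ ∞ u) :
    IsWeakDeriv (fun x => f x * u x) fun x => f' x * u x + f x * deriv u x := fun φ hφ hc => by
  have hu' : ContDiff ℝ ∞ (deriv u) := hu.deriv'
  have hφ' : ContDiff ℝ ∞ (deriv φ) := hφ.deriv'
  have huφ : Integrable fun x => f x * (u x * deriv φ x) :=
    hf.integrable_smul_right_of_hasCompactSupport (hu.continuous.mul hφ'.continuous)
      hc.deriv.mul_left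
  have hu'φ : Integrable fun x => f x * (deriv u x * φ x) :=
    hf.integrable_smul_right_of_hasCompactSupport (hu'.continuous.mul hφ.continuous) hc.mul_left
  have hf'uφ : Integrable fun x => f' x * (u x * φ x) :=
    hf'.integrable_smul_right_of_hasCompactSupport (hu.continuous.mul hφ.continuous) hc.mul_left
  have htest := h (fun x => u x * φ x) (hu.mul hφ) hc.mul_left
  have hderiv : ∀ x, f x * deriv (fun x => u x * φ x) x =
      f x * (deriv u x * φ x) + f x * (u x * deriv φ x) := fun x => by
    rw [deriv_fun_mul (hu.differentiable (by simp) x) (hφ.differentiable (by simp) x), mul_add]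
  simp only [hderiv] at htest
  rw [integral_add hu'φ huφ] at htest
  simp only [add_mul, mul_assoc]
  rw [integral_add hf'uφ hu'φ]
  linear_combination htest

protected theorem star (h : IsWeakDeriv f f') :
    IsWeakDeriv (fun x => conj (f x)) fun x => conj (f' x) := fun φ hφ hc => by
  have htest := congrArg (starRingEnd ℂ) (h (fun x => conj (φ x))
    (Complex.conjCLE.contDiff.comp hφ) (hc.comp_left (map_zero _)))
  simpa only [← integral_conj, map_neg, map_mul, Complex.conj_conj, deriv_conj] using htest

end IsWeakDeriv

namespace FormDomain

variable (g : FormDomain) {u : ℝ → ℂ}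

theorem isWeakDeriv_conj_mul (hu : ContDiff ℝ ∞ u) : IsWeakDeriv (fun x => conj (g.toFun x) * u x)
    fun x => conj (g.wderiv x) * u x + conj (g.toFun x) * deriv u x :=
  g.isWeakDeriv.star.mul_contDiff (g.memLp_toFun.star.locallyIntegrable (by norm_num))
    (g.memLp_wderiv.star.locallyIntegrable (by norm_num)) hu

theorem continuous_conj_mul (hu : Continuous u) : Continuous fun x => conj (g.toFun x) * u x :=
  g.continuous_toFun.star.mul hu

theorem locallyIntegrable_conj_mul (hu : ContDiff ℝ ∞ u) :
    LocallyIntegrable fun x => conj (g.wderiv x) * u x + conj (g.toFun x) * deriv u x :=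
  ((g.memLp_wderiv.star.locallyIntegrable (by norm_num)).mul_continuous hu.continuous).add
    (g.continuous_conj_mul (hu.continuous_deriv (by simp))).locallyIntegrable

end FormDomain

/-- `u` is a smooth function on the line such that `u` and `u'` are square integrable on `S`. The
eigenfunctions are glued from two such functions, on complementary half-lines `S`. -/
structure SmoothL2On (S : Set ℝ) (u : ℝ → ℂ) : Prop where
  contDiff : ContDiff ℝ ∞ u
  memLp : MemLp u 2 (volume.restrict S)
  memLp_deriv : MemLp (deriv u) 2 (volume.restrict S)

theorem memLp_comp_neg_Iic {u : ℝ → ℂ} {s : ℝ} (hu : MemLp u 2 (volume.restrict (Ioi (-s)))) :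
    MemLp (fun x => u (-x)) 2 (volume.restrict (Iic s)) := by
  rw [← restrict_Iio_eq_restrict_Iic]
  have hneg := (Measure.measurePreserving_neg (volume : Measure ℝ)).restrict_preimage
    (measurableSet_Ioi (a := -s))
  have hpre : Neg.neg ⁻¹' Ioi (-s) = Iio s := by
    ext x
    simp
  rw [hpre] at hneg
  exact hu.comp_measurePreserving hneg

theorem memLp_piecewise_Iic {u v : ℝ → ℂ} {s : ℝ} (hv : MemLp v 2 (volume.restrict (Iic s)))
    (hu : MemLp u 2 (volume.restrict (Ioi s))) : MemLp ((Iic s).piecewise v u) 2 volume :=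
  .piecewise measurableSet_Iic hv (compl_Iic (a := s) ▸ hu)

namespace SmoothL2On

variable {S : Set ℝ} {u v : ℝ → ℂ} {s : ℝ}

theorem const_mul (hu : SmoothL2On S u) (c : ℂ) : SmoothL2On S fun x => c * u x where
  contDiff := contDiff_const.mul hu.contDiff
  memLp := hu.memLp.const_mul c
  memLp_deriv := by
    rw [deriv_const_mul_field']
    exact hu.memLp_deriv.const_mul c

theorem comp_neg (hu : SmoothL2On (Ioi (-s)) u) : SmoothL2On (Iic s) fun x => u (-x) where
  contDiff := hu.contDiff.comp contDiff_neg
  memLp := memLp_comp_neg_Iic hu.memLp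
  memLp_deriv := by
    have hderiv : deriv (fun x => u (-x)) = -fun x => deriv u (-x) :=
      funext fun x => deriv_comp_neg u x
    rw [hderiv]
    exact (memLp_comp_neg_Iic hu.memLp_deriv).neg

theorem integrableOn_mul (hu : SmoothL2On S u) (g : FormDomain) :
    IntegrableOn (fun x => conj (g.toFun x) * u x) S :=
  (g.memLp_toFun.star.restrict S).integrable_mul hu.memLp

theorem integrableOn_deriv_mul (hu : SmoothL2On S u) (g : FormDomain) :
    IntegrableOn (fun x => conj (g.wderiv x) * u x + conj (g.toFun x) * deriv u x) S :=
  ((g.memLp_wderiv.star.restrict S).integrable_mul hu.memLp).add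
    ((g.memLp_toFun.star.restrict S).integrable_mul hu.memLp_deriv)

theorem integral_Ioi (hu : SmoothL2On (Ioi s) u) (g : FormDomain) :
    ∫ x in Ioi s, (conj (g.wderiv x) * u x + conj (g.toFun x) * deriv u x) =
      -(conj (g.toFun s) * u s) :=
  (g.isWeakDeriv_conj_mul hu.contDiff).integral_Ioi (g.continuous_conj_mul hu.contDiff.continuous)
    (g.locallyIntegrable_conj_mul hu.contDiff) (hu.integrableOn_mul g) (hu.integrableOn_deriv_mul g)

theorem integral_Iic (hu : SmoothL2On (Iic s) u) (g : FormDomain) :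
    ∫ x in Iic s, (conj (g.wderiv x) * u x + conj (g.toFun x) * deriv u x) =
      conj (g.toFun s) * u s :=
  (g.isWeakDeriv_conj_mul hu.contDiff).integral_Iic (g.continuous_conj_mul hu.contDiff.continuous)
    (g.locallyIntegrable_conj_mul hu.contDiff) (hu.integrableOn_mul g) (hu.integrableOn_deriv_mul g)

theorem l2Pairing_piecewise (hv : SmoothL2On (Iic s) v) (hu : SmoothL2On (Ioi s) u)
    (g : FormDomain) :
    l2Pairing ((Iic s).piecewise v u) g.wderiv +
      l2Pairing ((Iic s).piecewise (deriv v) (deriv u)) g.toFun =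
        (v s - u s) * conj (g.toFun s) := by
  have hint := integrable_mul_conj (memLp_piecewise_Iic hv.memLp hu.memLp) g.memLp_wderiv
  have hint' :=
    integrable_mul_conj (memLp_piecewise_Iic hv.memLp_deriv hu.memLp_deriv) g.memLp_toFun
  have hadd := hint.add hint'
  simp only [Pi.add_def] at hadd
  rw [l2Pairing, l2Pairing, ← integral_add hint hint',
    ← intervalIntegral.integral_Iic_add_Ioi (b := s) hadd.integrableOn hadd.integrableOn,
    sub_mul, sub_eq_add_neg, mul_comm (v s), mul_comm (u s), ← hv.integral_Iic, ← hu.integral_Ioi]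
  congr 1
  · refine setIntegral_congr_fun measurableSet_Iic fun x hx => ?_
    simp only [piecewise_eq_of_mem _ _ _ hx]
    ring
  · refine setIntegral_congr_fun measurableSet_Ioi fun x (hx : s < x) => ?_
    simp only [piecewise_eq_of_notMem _ _ _ (notMem_Iic.mpr hx)]
    ring

end SmoothL2On

/-- The element of the form domain equal to `v` on `(-∞, s]` and to `u` on `(s, ∞)`. -/
noncomputable def FormDomain.glue {s : ℝ} {u v : ℝ → ℂ} (hv : SmoothL2On (Iic s) v)
    (hu : SmoothL2On (Ioi s) u) (hvx : MemLp (fun x : ℝ => x * v x) 2 (volume.restrict (Iic s)))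
    (hux : MemLp (fun x : ℝ => x * u x) 2 (volume.restrict (Ioi s))) (hs : v s = u s) :
    FormDomain where
  toFun := (Iic s).piecewise v u
  wderiv := (Iic s).piecewise (deriv v) (deriv u)
  continuous_toFun := hv.contDiff.continuous.if_le hu.contDiff.continuous continuous_id
    continuous_const fun x hx => by rw [show x = s from hx, hs]
  memLp_toFun := memLp_piecewise_Iic hv.memLp hu.memLp
  memLp_wderiv := memLp_piecewise_Iic hv.memLp_deriv hu.memLp_deriv
  isWeakDeriv φ hφ hc := by
    have hparts := hv.l2Pairing_piecewise hu (.ofTest (fun x => conj (φ x))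
      (Complex.conjCLE.contDiff.comp hφ) (hc.comp_left (map_zero _)))
    simp only [l2Pairing, ofTest, deriv_conj, Complex.conj_conj, hs, sub_self, zero_mul] at hparts
    exact eq_neg_of_add_eq_zero_left hparts
  memLp_mul := by
    convert! memLp_piecewise_Iic hvx hux using 1
    ext x
    by_cases hx : x ∈ Iic s <;> simp only [piecewise, hx, if_true, if_false]

/-! ### Green function and eigenvalues -/

theorem deriv_parabolicD_ofReal (ν : ℂ) :
    deriv (fun x : ℝ => parabolicD ν x) = fun x : ℝ => parabolicDDeriv ν x :=
  funext fun x => (hasDerivAt_parabolicD ν x).comp_ofReal.deriv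

theorem deriv_parabolicDDeriv_ofReal (ν : ℂ) : deriv (fun x : ℝ => parabolicDDeriv ν x) =
    fun x : ℝ => ((x : ℂ) ^ 2 / 4 - 1 / 2 - ν) * parabolicD ν x :=
  funext fun x => (hasDerivAt_parabolicDDeriv ν x).comp_ofReal.deriv

theorem contDiff_comp_ofReal {F : ℂ → ℂ} (hF : Differentiable ℂ F) :
    ContDiff ℝ ∞ fun x : ℝ => F x :=
  (hF.contDiff.restrict_scalars ℝ).comp Complex.ofRealCLM.contDiff

theorem contDiff_parabolicD (ν : ℂ) : ContDiff ℝ ∞ fun x : ℝ => parabolicD ν x :=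
  contDiff_comp_ofReal fun x => (hasDerivAt_parabolicD ν x).differentiableAt

theorem contDiff_parabolicDDeriv (ν : ℂ) : ContDiff ℝ ∞ fun x : ℝ => parabolicDDeriv ν x :=
  contDiff_comp_ofReal fun x => (hasDerivAt_parabolicDDeriv ν x).differentiableAt

theorem memLp_ofReal_mul_parabolicD (ν : ℂ) (s : ℝ) :
    MemLp (fun x : ℝ => (x : ℂ) * parabolicD ν x) 2 (volume.restrict (Ioi s)) :=
  (superexpDecay_parabolicD ν).ofReal_mul.memLp_Ioi
    (Complex.continuous_ofReal.mul (contDiff_parabolicD ν).continuous) s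

theorem smoothL2On_parabolicD (ν : ℂ) (s : ℝ) :
    SmoothL2On (Ioi s) fun x => parabolicD ν x where
  contDiff := contDiff_parabolicD ν
  memLp := (superexpDecay_parabolicD ν).memLp_Ioi (contDiff_parabolicD ν).continuous s
  memLp_deriv := by
    rw [deriv_parabolicD_ofReal]
    exact (superexpDecay_parabolicDDeriv ν).memLp_Ioi (contDiff_parabolicDDeriv ν).continuous s

theorem smoothL2On_parabolicDDeriv (ν : ℂ) (s : ℝ) :
    SmoothL2On (Ioi s) fun x => parabolicDDeriv ν x where
  contDiff := contDiff_parabolicDDeriv ν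
  memLp := deriv_parabolicD_ofReal ν ▸ (smoothL2On_parabolicD ν s).memLp_deriv
  memLp_deriv := by
    rw [deriv_parabolicDDeriv_ofReal]
    have hcont := (contDiff_parabolicD ν).continuous
    have hdecay := superexpDecay_parabolicD ν
    convert! ((hdecay.ofReal_mul.ofReal_mul.const_mul (1 / 4)).sub
      (hdecay.const_mul (1 / 2 + ν))).memLp_Ioi (by fun_prop) s using 2
    ring

/-- The Green function `x ↦ D_ν(max(x, s)) D_ν(-min(x, s))` of the Weber equation with pole `s`, as
an element of the form domain. It is not divided by the Wronskian. -/
noncomputable def weberGreen (ν : ℂ) (s : ℝ) : FormDomain :=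
  .glue ((smoothL2On_parabolicD ν (-s)).comp_neg.const_mul (parabolicD ν s))
    ((smoothL2On_parabolicD ν s).const_mul (parabolicD ν (-s : ℝ)))
    (by
      convert! (memLp_comp_neg_Iic (memLp_ofReal_mul_parabolicD ν (-s))).const_mul
        (-parabolicD ν s) using 2
      push_cast
      ring)
    (by simpa only [mul_left_comm] using
      (memLp_ofReal_mul_parabolicD ν s).const_mul (parabolicD ν (-s : ℝ)))
    (mul_comm _ _)

theorem weberGreen_of_le (ν : ℂ) {s x : ℝ} (h : x ≤ s) :
    (weberGreen ν s).toFun x = parabolicD ν s * parabolicD ν (-x : ℝ) :=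
  if_pos h

theorem weberGreen_of_ge (ν : ℂ) {s x : ℝ} (h : s ≤ x) :
    (weberGreen ν s).toFun x = parabolicD ν (-s : ℝ) * parabolicD ν x := by
  rcases h.eq_or_lt with rfl | h
  · rw [weberGreen_of_le ν le_rfl, mul_comm]
  · exact if_neg (not_le.mpr h)

theorem weberGreen_wderiv (ν : ℂ) (s : ℝ) : (weberGreen ν s).wderiv =
    (Iic s).piecewise (fun x => -parabolicD ν s * parabolicDDeriv ν (-x : ℝ))
      fun x => parabolicD ν (-s : ℝ) * parabolicDDeriv ν x := by
  have hneg : ∀ x : ℝ, deriv (fun x : ℝ => parabolicD ν (-x : ℝ)) x = -parabolicDDeriv ν (-x : ℝ) :=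
    fun x => by
      rw [deriv_comp_neg fun x : ℝ => parabolicD ν x, deriv_parabolicD_ofReal]
  simp only [weberGreen, FormDomain.glue, deriv_const_mul_field', deriv_parabolicD_ofReal]
  congr with x
  rw [hneg]
  ring

theorem l2Pairing_quadratic_mul (f g : FormDomain) (c : ℂ) :
    l2Pairing (fun x : ℝ => ((x : ℂ) ^ 2 / 4 - c) * f.toFun x) g.toFun =
      1 / 4 * l2Pairing (fun x : ℝ => (x : ℂ) * f.toFun x) (fun x : ℝ => (x : ℂ) * g.toFun x) -
        c * l2Pairing f.toFun g.toFun := by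
  simp only [l2Pairing]
  rw [← integral_const_mul, ← integral_const_mul, ← integral_sub
    ((integrable_mul_conj f.memLp_mul g.memLp_mul).const_mul _)
    ((integrable_mul_conj f.memLp_toFun g.memLp_toFun).const_mul _)]
  congr with x
  rw [map_mul, Complex.conj_ofReal]
  ring

theorem pcForm_zero_weberGreen (ν : ℂ) (b s : ℝ) (g : FormDomain) :
    pcForm 0 b (weberGreen ν s) g = ν * l2Pairing (weberGreen ν s).toFun g.toFun +
      weberWronskian ν * conj (g.toFun s) := by
  have hparts := ((smoothL2On_parabolicDDeriv ν (-s)).comp_neg.const_mul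
    (-parabolicD ν s)).l2Pairing_piecewise
      ((smoothL2On_parabolicDDeriv ν s).const_mul (parabolicD ν (-s : ℝ))) g
  have hsecond : (Iic s).piecewise
      (deriv fun x => -parabolicD ν s * parabolicDDeriv ν (-x : ℝ))
      (deriv fun x => parabolicD ν (-s : ℝ) * parabolicDDeriv ν x) =
        fun x : ℝ => ((x : ℂ) ^ 2 / 4 - (1 / 2 + ν)) * (weberGreen ν s).toFun x := by
    have hneg : ∀ x : ℝ, deriv (fun x : ℝ => parabolicDDeriv ν (-x : ℝ)) x =
        -(((-x : ℝ) ^ 2 / 4 - 1 / 2 - ν) * parabolicD ν (-x : ℝ)) := fun x => by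
      rw [deriv_comp_neg fun x : ℝ => parabolicDDeriv ν x, deriv_parabolicDDeriv_ofReal]
    simp only [deriv_const_mul_field', deriv_parabolicDDeriv_ofReal]
    ext x
    rcases le_or_gt x s with h | h
    · rw [piecewise_eq_of_mem _ _ _ (mem_Iic.mpr h), weberGreen_of_le ν h, hneg]
      push_cast
      ring
    · rw [piecewise_eq_of_notMem _ _ _ (notMem_Iic.mpr h), weberGreen_of_ge ν h.le]
      ring
  rw [← weberGreen_wderiv, hsecond, l2Pairing_quadratic_mul] at hparts
  have hW := wronskian_parabolicD ν s
  rw [pcForm]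
  push_cast at hparts
  linear_combination hparts + conj (g.toFun s) * hW

theorem pcForm_eq_zero_add (z : ℂ) (b : ℝ) (f g : FormDomain) : pcForm z b f g =
    pcForm 0 b f g + z * (f.toFun b * conj (g.toFun b) - f.toFun (-b) * conj (g.toFun (-b))) := by
  simp only [pcForm, zero_mul, add_zero]

theorem isEigenvalue_of_pcForm {z ν : ℂ} {b : ℝ} (f : FormDomain) (hf : f.toFun ≠ 0)
    (h : ∀ g : FormDomain, pcForm z b f g = ν * l2Pairing f.toFun g.toFun) :
    IsEigenvalue (pcOperator z b) ν := by
  set y : Lp ℂ 2 (volume : Measure ℝ) := f.memLp_toFun.toLp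
  have hyf : (y : ℝ → ℂ) =ᵐ[volume] f.toFun := f.memLp_toFun.coeFn_toLp
  have hgraph : (y, ν • y) ∈ (pcOperator z b).graph := by
    rw [pcOperator_graph]
    refine ⟨f, hyf.symm, fun g => ?_⟩
    rw [h g, ← l2Pairing_smul]
    refine l2Pairing_congr ?_ _
    filter_upwards [Lp.coeFn_smul ν y, hyf] with x hsmul hx
    rw [hsmul, Pi.smul_apply, hx, smul_eq_mul]
  obtain ⟨w, hwy, hTw⟩ := (LinearPMap.mem_graph_iff _).mp hgraph
  refine ⟨w, fun hw => hf ?_, by rw [hTw, hwy]⟩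
  have hy : y = 0 := hwy.symm.trans hw
  rw [hy] at hyf
  exact (f.continuous_toFun.ae_eq_iff_eq volume continuous_zero).mp
    (hyf.symm.trans (Lp.coeFn_zero ℂ 2 volume))

/-- The combination `p G_b + q G_{-b}` of the Green functions with poles at the two point
interactions; the eigenfunctions of `L_{z,b}` are sought in this form. -/
noncomputable def weberGreenComb (ν : ℂ) (b : ℝ) (p q : ℂ) : FormDomain :=
  ((weberGreen ν b).smul p).add ((weberGreen ν (-b)).smul q)

theorem weberGreenComb_apply (ν : ℂ) (b : ℝ) (p q : ℂ) (x : ℝ) :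
    (weberGreenComb ν b p q).toFun x =
      p * (weberGreen ν b).toFun x + q * (weberGreen ν (-b)).toFun x :=
  rfl

theorem pcForm_weberGreenComb (z ν p q : ℂ) (b : ℝ) (g : FormDomain) :
    pcForm z b (weberGreenComb ν b p q) g = ν * l2Pairing (weberGreenComb ν b p q).toFun g.toFun +
      (weberWronskian ν * p + z * (weberGreenComb ν b p q).toFun b) * conj (g.toFun b) +
      (weberWronskian ν * q - z * (weberGreenComb ν b p q).toFun (-b)) * conj (g.toFun (-b)) := by
  have hpairing : l2Pairing (weberGreenComb ν b p q).toFun g.toFun =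
      p * l2Pairing (weberGreen ν b).toFun g.toFun +
        q * l2Pairing (weberGreen ν (-b)).toFun g.toFun := by
    rw [← l2Pairing_smul, ← l2Pairing_smul]
    exact l2Pairing_add ((weberGreen ν b).memLp_toFun.const_mul p)
      ((weberGreen ν (-b)).memLp_toFun.const_mul q) g.memLp_toFun
  rw [pcForm_eq_zero_add, hpairing]
  nth_rw 1 [weberGreenComb]
  rw [pcForm_add, pcForm_smul, pcForm_smul, pcForm_zero_weberGreen, pcForm_zero_weberGreen]
  ring

theorem isEigenvalue_of_weberGreenComb {z ν p q : ℂ} {b : ℝ} (hW : weberWronskian ν ≠ 0)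
    (hpq : p ≠ 0 ∨ q ≠ 0)
    (hp : weberWronskian ν * p + z * (weberGreenComb ν b p q).toFun b = 0)
    (hq : weberWronskian ν * q - z * (weberGreenComb ν b p q).toFun (-b) = 0) :
    IsEigenvalue (pcOperator z b) ν := by
  refine isEigenvalue_of_pcForm (weberGreenComb ν b p q) (fun hzero => ?_) fun g => ?_
  · rw [hzero, Pi.zero_apply, mul_zero] at hp hq
    simp_all
  · rw [pcForm_weberGreenComb, hp, hq]
    ring

/-- The function `ν ↦ D_ν(b)² (D_ν(-b)² - D_ν(b)²) / W(ν)²`, with `W` the Wronskian of `D_ν(x)` and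
`D_ν(-x)`; the eigenvalues `ν` of `L_{z,b}` that are not natural numbers are the solutions of
`z² χ(ν) = 1`. At natural numbers, where `W` vanishes, its value is `0`. -/
noncomputable def characteristicFunction (b : ℝ) (ν : ℂ) : ℂ :=
  parabolicD ν b ^ 2 * (parabolicD ν (-b : ℝ) ^ 2 - parabolicD ν b ^ 2) / weberWronskian ν ^ 2

theorem isEigenvalue_of_characteristicFunction {z ν : ℂ} {b : ℝ} (hb : 0 ≤ b)
    (h : z ^ 2 * characteristicFunction b ν = 1) : IsEigenvalue (pcOperator z b) ν := by
  set W := weberWronskian ν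
  set d := parabolicD ν b
  set e := parabolicD ν (-b : ℝ)
  have hW : W ≠ 0 := fun hW => by simp [characteristicFunction, W, hW] at h
  have hdet : (!![W + z * (d * e), z * d ^ 2; -(z * d ^ 2), W - z * (d * e)]).det = 0 := by
    rw [characteristicFunction, mul_div_assoc', div_eq_one_iff_eq (pow_ne_zero 2 hW)] at h
    rw [Matrix.det_fin_two_of]
    linear_combination -h
  obtain ⟨c, hc, hMc⟩ := Matrix.exists_mulVec_eq_zero_iff.mpr hdet
  have hrow₀ := congrFun hMc 0
  have hrow₁ := congrFun hMc 1
  simp only [Matrix.mulVec, dotProduct, Fin.sum_univ_two, Matrix.of_apply, Matrix.cons_val_zero,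
    Matrix.cons_val_one, Pi.zero_apply] at hrow₀ hrow₁
  refine isEigenvalue_of_weberGreenComb (p := c 0) (q := c 1) hW ?_ ?_ ?_
  · exact Fin.exists_fin_two.mp (Function.ne_iff.mp hc)
  · rw [weberGreenComb_apply, weberGreen_of_le ν le_rfl, weberGreen_of_ge ν (neg_le_self hb),
      neg_neg]
    linear_combination hrow₀
  · rw [weberGreenComb_apply, weberGreen_of_le ν (neg_le_self hb), weberGreen_of_le ν le_rfl,
      neg_neg]
    linear_combination hrow₁

/-! ### Zeros of the characteristic function near a zero of `D_ν(b)` -/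

theorem characteristicFunction_conj (b : ℝ) (ν : ℂ) :
    characteristicFunction b (conj ν) = conj (characteristicFunction b ν) := by
  have hD : ∀ x : ℝ, parabolicD (conj ν) x = conj (parabolicD ν x) := fun x => by
    rw [← parabolicD_conj, Complex.conj_ofReal]
  simp only [characteristicFunction, hD, weberWronskian_conj, map_div₀, map_mul, map_sub, map_pow]

theorem exists_ofReal_eq_parabolicD (ν x : ℝ) : ∃ d : ℝ, parabolicD ν x = d := by
  have h := parabolicD_conj ν x
  rw [Complex.conj_ofReal, Complex.conj_ofReal] at h
  exact Complex.conj_eq_iff_real.mp h.symm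

theorem exists_ofReal_eq_weberWronskian (ν : ℝ) : ∃ w : ℝ, weberWronskian ν = w := by
  have h := weberWronskian_conj ν
  rw [Complex.conj_ofReal] at h
  exact Complex.conj_eq_iff_real.mp h.symm

theorem characteristicFunction_re_nonneg {b ν : ℝ}
    (h : 0 < (parabolicD ν (-b : ℝ) ^ 2 - parabolicD ν b ^ 2).re) :
    0 ≤ (characteristicFunction b ν).re := by
  obtain ⟨d, hd⟩ := exists_ofReal_eq_parabolicD ν b
  obtain ⟨e, he⟩ := exists_ofReal_eq_parabolicD ν (-b)
  obtain ⟨w, hw⟩ := exists_ofReal_eq_weberWronskian ν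
  rw [hd, he] at h
  rw [characteristicFunction, hd, he, hw]
  norm_cast at h ⊢
  positivity

theorem parabolicD_neg_ne_zero {ν : ℂ} {b : ℝ} (hW : weberWronskian ν ≠ 0)
    (hD : parabolicD ν b = 0) : parabolicD ν (-b : ℝ) ≠ 0 := by
  intro h
  rw [Complex.ofReal_neg] at h
  apply hW
  rw [← wronskian_parabolicD ν b, hD, h, zero_mul, mul_zero, add_zero, neg_zero]

theorem eventually_parabolicD_sq_sub_sq_re_pos {b lam : ℝ} (hW : weberWronskian lam ≠ 0)
    (hD : parabolicD lam b = 0) :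
    ∀ᶠ ν : ℂ in 𝓝 (lam : ℂ), 0 < (parabolicD ν (-b : ℝ) ^ 2 - parabolicD ν b ^ 2).re := by
  have hcont : Continuous fun ν : ℂ => (parabolicD ν (-b : ℝ) ^ 2 - parabolicD ν b ^ 2).re :=
    Complex.continuous_re.comp <| ((differentiable_parabolicD_index (-b : ℝ)).continuous.pow 2).sub
      ((differentiable_parabolicD_index b).continuous.pow 2)
  refine hcont.continuousAt.eventually_const_lt ?_
  have hD' := parabolicD_neg_ne_zero hW hD
  obtain ⟨e, he⟩ := exists_ofReal_eq_parabolicD lam (-b)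
  beta_reduce
  rw [he] at hD' ⊢
  rw [hD, zero_pow two_ne_zero, sub_zero]
  norm_cast at hD' ⊢
  positivity

theorem eventually_parabolicD_ne_zero (x lam : ℂ) : ∀ᶠ ν in 𝓝[≠] lam, parabolicD ν x ≠ 0 := by
  have hD : AnalyticOnNhd ℂ (fun ν => parabolicD ν x) univ :=
    Complex.analyticOnNhd_univ_iff_differentiable.mpr (differentiable_parabolicD_index x)
  refine ((hD lam (mem_univ _)).eventually_eq_zero_or_eventually_ne_zero).resolve_left fun h => ?_
  have hzero := congrFun (hD.eq_of_eventuallyEq (g := 0) analyticOnNhd_const h) 0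
  rw [parabolicD_zero] at hzero
  exact Complex.exp_ne_zero _ hzero

theorem nhds_zero_le_map_characteristicFunction {b lam : ℝ} (hW : weberWronskian lam ≠ 0)
    (hD : parabolicD lam b = 0) :
    𝓝 0 ≤ map (characteristicFunction b) (𝓝 (lam : ℂ)) := by
  have hDb := (differentiable_parabolicD_index b).analyticAt (lam : ℂ)
  have hDb' := (differentiable_parabolicD_index (-b : ℝ)).analyticAt (lam : ℂ)
  have hWan := differentiable_weberWronskian.analyticAt (lam : ℂ)
  have hχ : AnalyticAt ℂ (characteristicFunction b) lam :=
    ((hDb.pow 2).mul ((hDb'.pow 2).sub (hDb.pow 2))).div (hWan.pow 2) (pow_ne_zero 2 hW)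
  have hχ0 : characteristicFunction b lam = 0 := by simp [characteristicFunction, hD]
  have hopen := hχ.eventually_constant_or_nhds_le_map_nhds
  rw [hχ0] at hopen
  refine hopen.resolve_left fun hconst => ?_
  have hnear := hconst.and
    ((eventually_parabolicD_sq_sub_sq_re_pos hW hD).and (hWan.continuousAt.eventually_ne hW))
  obtain ⟨ν, hνD, hνχ, hνpos, hνW⟩ :=
    ((eventually_parabolicD_ne_zero b lam).and (hnear.filter_mono nhdsWithin_le_nhds)).exists
  have hdiff : parabolicD ν (-b : ℝ) ^ 2 - parabolicD ν b ^ 2 ≠ 0 := fun h => by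
    rw [h, Complex.zero_re] at hνpos
    exact hνpos.false
  exact div_ne_zero (mul_ne_zero (pow_ne_zero 2 hνD) hdiff) (pow_ne_zero 2 hνW) hνχ

theorem eventually_exists_nonreal_characteristicFunction_eq {b lam ρ : ℝ}
    (hW : weberWronskian lam ≠ 0) (hD : parabolicD lam b = 0) (hρ : 0 < ρ) :
    ∀ᶠ r : ℝ in atTop, ∃ ν : ℂ, ν.im ≠ 0 ∧ ‖ν - lam‖ < ρ ∧
      (Complex.I * r) ^ 2 * characteristicFunction b ν = 1 := by
  have hnear : ∀ᶠ ν : ℂ in 𝓝 (lam : ℂ), ‖ν - lam‖ < ρ ∧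
      0 < (parabolicD ν (-b : ℝ) ^ 2 - parabolicD ν b ^ 2).re :=
    (eventually_norm_sub_lt _ hρ).and (eventually_parabolicD_sq_sub_sq_re_pos hW hD)
  have htendsto : Tendsto (fun r : ℝ => ((-(r ^ 2)⁻¹ : ℝ) : ℂ)) atTop (𝓝 0) := by
    rw [← Complex.ofReal_zero, ← neg_zero]
    exact (Complex.continuous_ofReal.tendsto _).comp
      (tendsto_inv_atTop_zero.comp (tendsto_pow_atTop two_ne_zero)).neg
  filter_upwards [htendsto (nhds_zero_le_map_characteristicFunction hW hD (image_mem_map hnear)),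
    eventually_gt_atTop 0] with r ⟨ν, ⟨hνρ, hνpos⟩, hνχ⟩ hr
  refine ⟨ν, fun him => ?_, hνρ, ?_⟩
  · have hreal : ν = ν.re := Complex.ext rfl him
    rw [hreal] at hνpos hνχ
    have hnonneg := characteristicFunction_re_nonneg hνpos
    rw [hνχ, Complex.ofReal_re, neg_nonneg] at hnonneg
    exact hnonneg.not_gt (by positivity)
  · rw [hνχ, mul_pow, Complex.I_sq]
    have hr0 : (r : ℂ) ≠ 0 := by exact_mod_cast hr.ne'
    push_cast
    field_simp

end PointHarmonic

theorem mainTheorem8 (b : ℝ) (hb : 0 < b) (lam : ℝ) (hlam : 0 < lam)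
    (hlamN : ∀ n : ℕ, lam ≠ (n : ℝ))
    (hD : PointHarmonic.parabolicD (lam : ℂ) (b : ℂ) = 0) (ρ : ℝ) (hρ : 0 < ρ) :
    ∃ δ : ℝ, 0 < δ ∧ ∀ r : ℝ, 1 / δ < r →
      ∃ ν₁ ν₂ : ℂ, ν₁ ≠ ν₂ ∧
        (ν₁.im ≠ 0 ∧ ‖ν₁ - (lam : ℂ)‖ < ρ ∧
          PointHarmonic.IsEigenvalue (PointHarmonic.pcOperator (Complex.I * (r : ℂ)) b) ν₁) ∧
        (ν₂.im ≠ 0 ∧ ‖ν₂ - (lam : ℂ)‖ < ρ ∧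
          PointHarmonic.IsEigenvalue (PointHarmonic.pcOperator (Complex.I * (r : ℂ)) b) ν₂) := by
  have hW : PointHarmonic.weberWronskian lam ≠ 0 :=
    PointHarmonic.weberWronskian_ne_zero fun n => by exact_mod_cast hlamN n
  obtain ⟨A, hA⟩ := Filter.eventually_atTop.mp
    (PointHarmonic.eventually_exists_nonreal_characteristicFunction_eq hW hD hρ)
  refine ⟨(max A 1)⁻¹, by positivity, fun r hr => ?_⟩
  rw [one_div, inv_inv] at hr
  obtain ⟨ν, him, hνρ, hχ⟩ := hA r ((le_max_left A 1).trans hr.le)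
  have hχ' : (Complex.I * r) ^ 2 * PointHarmonic.characteristicFunction b (conj ν) = 1 := by
    have h := congrArg conj hχ
    simpa [PointHarmonic.characteristicFunction_conj] using h
  refine ⟨ν, conj ν, fun h => him (Complex.conj_eq_iff_im.mp h.symm),
    ⟨him, hνρ, PointHarmonic.isEigenvalue_of_characteristicFunction hb.le hχ⟩,
    by rwa [Complex.conj_im, neg_ne_zero], ?_,
    PointHarmonic.isEigenvalue_of_characteristicFunction hb.le hχ'⟩
  rwa [← Complex.conj_ofReal, ← map_sub, Complex.norm_conj]
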